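/- Let $X$ be a smooth $n$-dimensional manifold, $Y\to X$ a smooth fibre bundle with bundle coordinates $(x^\lambda,y^i)$ (even fields), $F\to Y$ a smooth vector bundle (odd fields $c^a$), and let $s^A=(y^i,c^a)$ denote all fields. Let $E_k=E_k^0\oplus E_k^1\to X$, $k=0,\dots,N$, be graded vector bundles whose fibre coordinates are the $k$-stage ghosts $c^{r_k}$ (even or odd) of ghost number $k+1$; write $c^r$ for $c^{r_0}$. Graded functions are polynomials in the anticommuting jets of the odd variables whose coefficients are smooth functions of finite jet order of the even variables; $d_\lambda$ are the total derivatives, $d_\Lambda$ their compositions for multi-indices $\Lambda$, and a vertical derivation $\upsilon=\upsilon^A\partial_A$ stands for its jet prolongation $\sum_{\Lambda}d_\Lambda\upsilon^A\,\partial_A^\Lambda$. For coefficients $f^\Lambda$ let $\eta(f)^\Lambda$ be the coefficients of the formal adjoint, $\sum(-1)^{|\Lambda|}d_\Lambda(\phi f^\Lambda)=\sum (d_\Lambda\phi)\,\eta(f)^\Lambda$. Let $L=\mathcal L\,d^nx$ be an even Lagrangian depending on the fields and their jets, with variational derivatives $\mathcal E_A=\sum(-1)^{|\Lambda|}d_\Lambda(\partial_A^\Lambda\mathcal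 L)$, satisfying Noether identities $\sum_{A,\Lambda}\Delta_r^{A,\Lambda}d_\Lambda\mathcal E_A=0$, and let $\Delta_{r_k}^{r_{k-1},\Lambda}$, $k=1,\dots,N$, be the coefficients of the linear parts of the $k$-stage Noether identities; all these coefficients depend on the fields and their jets only. Let $$\mathbf u=u+u^{(1)}+\dots+u^{(N)},\qquad u=u^A\frac{\partial}{\partial s^A},\quad u^A=\sum_{r,\Lambda} c^r_\Lambda u_r^{A,\Lambda},\quad u_r^{A,\Lambda}=\eta(\Delta_r^A)^\Lambda,$$ $$u^{(k)}=u^{r_{k-1}}\frac{\partial}{\partial c^{r_{k-1}}},\qquad u^{r_{k-1}}=\sum_{r_k,\Lambda} c^{r_k}_\Lambda\,\eta(\Delta^{r_{k-1}}_{r_k})^\Lambda,$$ be the associated gauge operator, an odd derivation of ghost number $1$, where $u$ is the odd gauge symmetry. Suppose that $\mathbf u$ admits a nilpotent extension, i.e. that there is an odd derivation $$\mathbf b=\mathbf u+\sum_{1\le k\le N+1}\gamma^{(k)},\qquad \gamma^{(k)}=\gamma^{r_{k-1}}\frac{\partial}{\partial c^{r_{k-1}}},$$ of ghost number $1$ with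 $\mathbf b\circ\mathbf b=0$, where each $\gamma^{r_{k-1}}$ is a polynomial, with all terms of degree at least $2$, in the ghosts and their jets, with coefficients depending on the fields and their jets. Then the Lie antibracket of $u$ is $$[u,u]=-2\gamma^{(1)}(u)=-2\sum_{r,\Lambda}d_\Lambda(\gamma^r)\,u_r^{B,\Lambda}\,\partial_B ,$$ where the $\gamma^r$ are quadratic in the ghosts $c^p$ and their jets. The right-hand side is a globally defined derivation and a generalized gauge symmetry of $L$ factorizing through $u$: it is a variational symmetry of $L$ (the Lie derivative of $L$ along it is variationally trivial, i.e. all its variational derivatives vanish), its components are given by a nonlinear (quadratic) differential operator in the $0$-stage ghosts, and it is obtained from the gauge symmetry $u=\sum c^r_\Lambda u_r^{A,\Lambda}\partial_A$ by putting $c^r=-2\gamma^r$. -/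

import Mathlib

open scoped TensorProduct Manifold ContDiff Topology
open Bundle (TotalSpace)

noncomputable section

namespace GradedJet

universe u v w z

/-! ## The local algebra of graded functions of finite jet order

Local coordinates: `x^λ` (`λ : Fin n`), even variables indexed by `E`, odd variables indexed by `O`,
and all their jets.  `W` is the open set in which `(x^λ, even variables)` take their values. -/

/-- Symmetric multi-indices `Λ` (the multiplicity of each of the `n` directions). -/
abbrev MIdx (n : ℕ) := Fin n →₀ ℕ

/-- The coordinates on the infinite jet space of the even variables. -/
abbrev Coord (n : ℕ) (E : Type) := Fin n ⊕ (E × MIdx n)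

section LocalAlgebra

variable {n : ℕ} {E O : Type}

/-- The infinite jet space of the even variables over the coordinate domain `W`. -/
def Jet (W : TopologicalSpace.Opens ((Fin n → ℝ) × (E → ℝ))) : Set (Coord n E → ℝ) :=
  {j | ((fun i => j (.inl i)), (fun e => j (.inr (e, 0)))) ∈ W}

variable (W : TopologicalSpace.Opens ((Fin n → ℝ) × (E → ℝ)))

/-- A function on the infinite jet space is smooth of finite jet order if it is a smooth function
of finitely many of the jet coordinates. -/
def IsSmoothFn (f : Jet W → ℝ) : Prop :=
  ∃ (S : Finset (Coord n E)) (g : (S → ℝ) → ℝ),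
    ∀ j : Jet W, f j = g (fun q => j.1 q) ∧ ContDiffAt ℝ ∞ g (fun q => j.1 q)

variable {W}

theorem IsSmoothFn.comp₂ {f f' : Jet W → ℝ} (hf : IsSmoothFn W f) (hf' : IsSmoothFn W f')
    (op : ℝ × ℝ → ℝ) (hop : ContDiff ℝ ∞ op) : IsSmoothFn W (fun j => op (f j, f' j)) := by
  classical
  obtain ⟨S, g, hg⟩ := hf
  obtain ⟨S', g', hg'⟩ := hf'
  let P : ((S ∪ S' : Finset _) → ℝ) →L[ℝ] (S → ℝ) := ContinuousLinearMap.pi fun q =>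
    ContinuousLinearMap.proj (⟨q.1, Finset.mem_union_left _ q.2⟩ : (S ∪ S' : Finset _))
  let P' : ((S ∪ S' : Finset _) → ℝ) →L[ℝ] (S' → ℝ) := ContinuousLinearMap.pi fun q =>
    ContinuousLinearMap.proj (⟨q.1, Finset.mem_union_right _ q.2⟩ : (S ∪ S' : Finset _))
  refine ⟨S ∪ S', fun v => op (g (P v), g' (P' v)), fun j => ⟨?_, ?_⟩⟩
  · change op (f j, f' j) = _
    rw [(hg j).1, (hg' j).1]; rfl
  · refine hop.contDiffAt.comp _ (ContDiffAt.prodMk ?_ ?_)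
    · exact ContDiffAt.comp _ (hg j).2 P.contDiff.contDiffAt
    · exact ContDiffAt.comp _ (hg' j).2 P'.contDiff.contDiffAt

theorem isSmoothFn_const (c : ℝ) : IsSmoothFn W (fun _ => c) :=
  ⟨∅, fun _ => c, fun _ => ⟨rfl, contDiffAt_const⟩⟩

theorem isSmoothFn_coord (q : Coord n E) : IsSmoothFn W (fun j => j.1 q) :=
  ⟨{q}, fun v => v ⟨q, Finset.mem_singleton_self q⟩,
    fun _ => ⟨rfl, (ContinuousLinearMap.proj (R := ℝ) (φ := fun _ : ({q} : Finset _) => ℝ)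
      ⟨q, Finset.mem_singleton_self q⟩).contDiff.contDiffAt⟩⟩

variable (W)

/-- The commutative algebra of smooth functions of finite order on the jet space. -/
def SmoothFn : Subalgebra ℝ (Jet W → ℝ) where
  carrier := {f | IsSmoothFn W f}
  mul_mem' ha hb := ha.comp₂ hb (fun p => p.1 * p.2) (contDiff_fst.mul contDiff_snd)
  add_mem' ha hb := ha.comp₂ hb (fun p => p.1 + p.2) (contDiff_fst.add contDiff_snd)
  algebraMap_mem' c := isSmoothFn_const c

variable {W}

/-- Extension by zero of a function on the jet space. -/
def ext0 (f : Jet W → ℝ) : (Coord n E → ℝ) → ℝ := Function.extend Subtype.val f 0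

open Classical in
theorem hasDerivAt_ext0 {f : Jet W → ℝ} {S : Finset (Coord n E)} {g : (S → ℝ) → ℝ}
    (hg : ∀ j : Jet W, f j = g (fun q => j.1 q) ∧ ContDiffAt ℝ ∞ g (fun q => j.1 q))
    (q : Coord n E) (j : Jet W) :
    HasDerivAt (fun t => ext0 f (Function.update j.1 q t))
      (if h : q ∈ S then fderiv ℝ g (fun q => j.1 q) (Pi.single ⟨q, h⟩ 1) else 0) (j.1 q) := by
  have hcont : Continuous (fun t : ℝ => Function.update j.1 q t) :=
    continuous_const.update q continuous_id
  have hopen : IsOpen (Jet W) := by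
    refine W.isOpen.preimage (f := fun j : Coord n E → ℝ =>
      ((fun i => j (.inl i)), (fun e => j (.inr (e, 0))))) ?_
    fun_prop
  have hmem : ∀ᶠ t in 𝓝 (j.1 q), Function.update j.1 q t ∈ Jet W := by
    refine hcont.continuousAt.eventually_mem (hopen.mem_nhds ?_)
    simp
  have hev : (fun t => ext0 f (Function.update j.1 q t)) =ᶠ[𝓝 (j.1 q)]
      fun t => g (fun p => Function.update j.1 q t p) := by
    filter_upwards [hmem] with t ht
    have h1 : ext0 f (Function.update j.1 q t) = f ⟨_, ht⟩ :=
      Subtype.val_injective.extend_apply f 0 (⟨_, ht⟩ : Jet W)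
    rw [h1, (hg ⟨_, ht⟩).1]
  refine HasDerivAt.congr_of_eventuallyEq ?_ hev
  split_ifs with h
  · have hup : (fun t => (fun p : S => Function.update j.1 q t p)) =
        fun t => Function.update (fun p : S => j.1 p) ⟨q, h⟩ t := by
      funext t p
      by_cases hp : p = ⟨q, h⟩
      · subst hp; simp
      · have : (p : Coord n E) ≠ q := fun e => hp (Subtype.ext e)
        simp [Function.update_of_ne, hp, this]
    have hd : HasDerivAt (fun t => (fun p : S => Function.update j.1 q t p))
        (Pi.single (⟨q, h⟩ : S) (1 : ℝ)) (j.1 q) := by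
      rw [hup]; exact hasDerivAt_update _ _ _
    have hG : HasFDerivAt g (fderiv ℝ g (fun p : S => j.1 p))
        ((fun t => (fun p : S => Function.update j.1 q t p)) (j.1 q)) := by
      have : (fun p : S => Function.update j.1 q (j.1 q) p) = fun p : S => j.1 p := by simp
      simp only [this]
      exact ((hg j).2.differentiableAt (by simp)).hasFDerivAt
    exact hG.comp_hasDerivAt _ hd
  · have : (fun t => g (fun p : S => Function.update j.1 q t p)) =
        fun _ => g (fun p : S => j.1 p) := by
      funext t
      congr 1
      funext p
      have : (p : Coord n E) ≠ q := fun e => h (e ▸ p.2)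
      simp [Function.update_of_ne, this]
    rw [this]
    exact hasDerivAt_const _ _

open Classical in
theorem isSmoothFn_deriv {f : Jet W → ℝ} (hf : IsSmoothFn W f) (q : Coord n E) :
    IsSmoothFn W (fun j => deriv (fun t => ext0 f (Function.update j.1 q t)) (j.1 q)) := by
  obtain ⟨S, g, hg⟩ := hf
  refine ⟨S, fun v => if h : q ∈ S then fderiv ℝ g v (Pi.single ⟨q, h⟩ 1) else 0, fun j => ⟨?_, ?_⟩⟩
  · exact (hasDerivAt_ext0 hg q j).deriv
  · by_cases h : q ∈ S
    · simp only [h, dite_true]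
      exact ((hg j).2.fderiv_right (m := ∞) (by simp)).clm_apply contDiffAt_const
    · simp only [h, dite_false]
      exact contDiffAt_const

open Classical in
theorem differentiableAt_ext0 (f : SmoothFn W) (q : Coord n E)
    (j : Jet W) :
    DifferentiableAt ℝ (fun t => ext0 f.1 (Function.update j.1 q t)) (j.1 q) := by
  obtain ⟨S, g, hg⟩ := f.2
  exact (hasDerivAt_ext0 hg q j).differentiableAt

theorem ext0_add (f f' : Jet W → ℝ) : ext0 (f + f') = ext0 f + ext0 f' := by
  funext a
  by_cases h : ∃ j : Jet W, j.1 = a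
  · obtain ⟨j, rfl⟩ := h
    simp [ext0]
  · simp only [ext0, Pi.add_apply]
    rw [Function.extend_apply' _ _ _ h, Function.extend_apply' _ _ _ h,
      Function.extend_apply' _ _ _ h]
    simp

theorem ext0_smul (c : ℝ) (f : Jet W → ℝ) : ext0 (c • f) = c • ext0 f := by
  funext a
  by_cases h : ∃ j : Jet W, j.1 = a
  · obtain ⟨j, rfl⟩ := h
    simp [ext0]
  · simp only [ext0, Pi.smul_apply]
    rw [Function.extend_apply' _ _ _ h, Function.extend_apply' _ _ _ h]
    simp

open Classical in
/-- The partial derivative of smooth functions with respect to a jet coordinate. -/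
def partialD (q : Coord n E) : SmoothFn W →ₗ[ℝ] SmoothFn W where
  toFun f := ⟨fun j => deriv (fun t => ext0 f.1 (Function.update j.1 q t)) (j.1 q),
    isSmoothFn_deriv f.2 q⟩
  map_add' f f' := by
    apply Subtype.ext
    funext j
    have := deriv_add (differentiableAt_ext0 f q j) (differentiableAt_ext0 f' q j)
    simp only [Subalgebra.coe_add, ext0_add]
    exact this
  map_smul' c f := by
    apply Subtype.ext
    funext j
    have := deriv_const_smul c (differentiableAt_ext0 f q j)
    simp only [SetLike.val_smul, ext0_smul]
    exact this

variable (O W)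

/-- The odd part of the local model: the Grassmann algebra on the jets of the odd variables. -/
abbrev OddAlg (n : ℕ) (O : Type) := ExteriorAlgebra ℝ ((O × MIdx n) →₀ ℝ)

/-- Graded functions of finite jet order: polynomials in the anticommuting jets of the odd
variables whose coefficients are smooth functions of finite order of the even ones. -/
abbrev JetAlg := SmoothFn W ⊗[ℝ] OddAlg n O

variable {O W}

/-- The graded function `s^A_Λ`, the jet of a variable; `A` is even (`inl`) or odd (`inr`). -/
def jetVar : (E ⊕ O) → MIdx n → JetAlg O W
  | .inl e, Λ => (⟨fun j => j.1 (.inr (e, Λ)), isSmoothFn_coord _⟩ : SmoothFn W) ⊗ₜ[ℝ] 1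
  | .inr o, Λ => 1 ⊗ₜ[ℝ] ExteriorAlgebra.ι ℝ (Finsupp.single (o, Λ) 1)

/-- The Grassmann parity of a variable. -/
def parity : (E ⊕ O) → ZMod 2
  | .inl _ => 0
  | .inr _ => 1

/-- `∂/∂x^λ`. -/
def pdx (i : Fin n) : JetAlg O W →ₗ[ℝ] JetAlg O W :=
  LinearMap.rTensor (OddAlg n O) (partialD (W := W) (.inl i))

/-- The left partial derivative `∂_A^Λ = ∂/∂s^A_Λ`. -/
def pd : (E ⊕ O) → MIdx n → (JetAlg O W →ₗ[ℝ] JetAlg O W)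
  | .inl e, Λ => LinearMap.rTensor (OddAlg n O) (partialD (W := W) (.inr (e, Λ)))
  | .inr o, Λ => LinearMap.lTensor (SmoothFn W)
      (CliffordAlgebra.contractLeft (Finsupp.lapply (R := ℝ) (o, Λ)))

/-- The graded functions of Grassmann parity `p`. -/
def parityPart (p : ZMod 2) : Submodule ℝ (JetAlg O W) :=
  LinearMap.range (LinearMap.lTensor (SmoothFn W)
    (CliffordAlgebra.evenOdd (0 : QuadraticForm ℝ ((O × MIdx n) →₀ ℝ)) p).subtype)

/-- The total derivative `d_λ = ∂_λ + ∑ s^A_{λ+Λ} ∂_A^Λ`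
(only finitely many terms are nonzero on a given graded function). -/
def totalD (i : Fin n) (φ : JetAlg O W) : JetAlg O W :=
  pdx i φ + ∑ᶠ a : (E ⊕ O) × MIdx n, jetVar a.1 (a.2 + Finsupp.single i 1) * pd a.1 a.2 φ

/-- `d_Λ`, the composition of the commuting total derivatives listed in `Λ`. -/
def totalDs (Λ : MIdx n) (φ : JetAlg O W) : JetAlg O W :=
  (List.finRange n).foldr (fun i ψ => (totalD i)^[Λ i] ψ) φ

/-- The vertical contact graded derivation `υ^A ∂_A + ∑_{0<|Λ|} d_Λ υ^A ∂_A^Λ`,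
the jet prolongation of `υ = υ^A ∂_A`. -/
def prolong (υ : (E ⊕ O) → JetAlg O W) (φ : JetAlg O W) : JetAlg O W :=
  ∑ᶠ a : (E ⊕ O) × MIdx n, totalDs a.2 (υ a.1) * pd a.1 a.2 φ

/-- The variational derivative `ℰ_A = ∑ (-1)^|Λ| d_Λ ∂_A^Λ ℒ` of the density `ℒ d^n x`. -/
def varD (A : E ⊕ O) (ℒ : JetAlg O W) : JetAlg O W :=
  ∑ᶠ Λ : MIdx n, ((-1 : ℝ) ^ Λ.degree) • totalDs Λ (pd A Λ ℒ)

/-- The density `ℒ d^n x` is variationally trivial, i.e. `δ`-closed. -/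
def IsVariationallyTrivial (ℒ : JetAlg O W) : Prop := ∀ A : E ⊕ O, varD A ℒ = 0

/-- The vertical derivation with components `υ` is a variational symmetry of `L = ℒ d^n x`: the
Lie derivative of `L`, which is `υ(ℒ) d^n x`, is variationally trivial. -/
def IsVariationalSymmetry (ℒ : JetAlg O W) (υ : (E ⊕ O) → JetAlg O W) : Prop :=
  IsVariationallyTrivial (prolong υ ℒ)

/-- The Lie (super)bracket of graded derivations `D`, `D'` of parities `p`, `p'`. -/
def lieBracket (p p' : ℕ) (D D' : JetAlg O W → JetAlg O W) (φ : JetAlg O W) : JetAlg O W :=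
  D (D' φ) - ((-1 : ℝ) ^ (p * p')) • D' (D φ)

/-- Nilpotency of a vertical graded derivation: its Lie derivative, which acts on the coefficients
of horizontal forms, squares to zero. -/
def IsNilpotentDer (D : JetAlg O W → JetAlg O W) : Prop := ∀ φ, D (D φ) = 0

/-- The coefficients `η(f)^Λ` of the formal adjoint of the differential operator `∑ f^Λ d_Λ`,
defined so that `∑ (-1)^|Λ| d_Λ (φ f^Λ) = ∑ (d_Λ φ) η(f)^Λ`. Sums run over unordered multi-indices,
hence the product of binomial coefficients. -/
def adj (f : MIdx n →₀ JetAlg O W) (Λ : MIdx n) : JetAlg O W :=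
  f.sum fun Ξ a => if Λ ≤ Ξ then
    ((-1 : ℝ) ^ Ξ.degree * ∏ i, ((Ξ i).choose (Λ i) : ℝ)) • totalDs (Ξ - Λ) a else 0

end LocalAlgebra

/-! ## Fields and ghosts -/

/-- Dimension of the base, numbers of even and odd fields, the highest stage of reducibility, and
the numbers of even and odd `s`-stage ghosts, `0 ≤ s ≤ N`. -/
structure FieldContent where
  n : ℕ
  m : ℕ
  k : ℕ
  N : ℕ
  g : Fin (N + 1) → ZMod 2 → ℕ

namespace FieldContent

variable (D : FieldContent)

/-- Indices `A` of the fields `s^A`: even or odd. -/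
abbrev Fld := Fin D.m ⊕ Fin D.k

/-- Indices `r_s` of the `s`-stage ghosts: even or odd. -/
abbrev Gh (s : Fin (D.N + 1)) := Fin (D.g s 0) ⊕ Fin (D.g s 1)

/-- Even variables: fields and ghosts. -/
abbrev EVar := Fin D.m ⊕ (Σ s : Fin (D.N + 1), Fin (D.g s 0))

/-- Odd variables: fields and ghosts. -/
abbrev OVar := Fin D.k ⊕ (Σ s : Fin (D.N + 1), Fin (D.g s 1))

/-- All variables. -/
abbrev Var := D.EVar ⊕ D.OVar

/-- A field as a variable. -/
def fld : D.Fld → D.Var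
  | .inl i => .inl (.inl i)
  | .inr a => .inr (.inl a)

/-- A ghost as a variable. -/
def gh {s : Fin (D.N + 1)} : D.Gh s → D.Var
  | .inl r => .inl (.inr ⟨s, r⟩)
  | .inr r => .inr (.inr ⟨s, r⟩)

/-- The domain of the coordinates `x^λ` and of all even variables, when `(x^λ, y^i)` run through
`U`; even ghosts are fibre coordinates of a vector bundle and take all real values. -/
def evenDom (U : TopologicalSpace.Opens ((Fin D.n → ℝ) × (Fin D.m → ℝ))) :
    TopologicalSpace.Opens ((Fin D.n → ℝ) × (D.EVar → ℝ)) :=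
  TopologicalSpace.Opens.comap
    ⟨fun p => (p.1, fun i => p.2 (.inl i)), by fun_prop⟩ U

variable (U : TopologicalSpace.Opens ((Fin D.n → ℝ) × (Fin D.m → ℝ)))

/-- The local algebra of graded functions of the fields, the ghosts and their jets. -/
abbrev Alg := JetAlg D.OVar (D.evenDom U)

variable {D U}

/-- Components of a derivation that acts on fields only. -/
def onFields (f : D.Fld → D.Alg U) : D.Var → D.Alg U
  | .inl (.inl i) => f (.inl i)
  | .inr (.inl a) => f (.inr a)
  | .inl (.inr _) => 0
  | .inr (.inr _) => 0

/-- Components of a derivation that acts on ghosts only. -/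
def onGhosts (f : ∀ s : Fin (D.N + 1), D.Gh s → D.Alg U) : D.Var → D.Alg U
  | .inl (.inl _) => 0
  | .inr (.inl _) => 0
  | .inl (.inr r) => f r.1 (.inl r.2)
  | .inr (.inr r) => f r.1 (.inr r.2)

variable (D U)

/-- The subspace of graded functions that depend on the fields and their jets only (the domain of
the even ghosts is all of their fibre, so vanishing derivatives mean independence). -/
def fieldFns : Submodule ℝ (D.Alg U) :=
  ⨅ (s : Fin (D.N + 1)) (r : D.Gh s) (Λ : MIdx D.n), LinearMap.ker (pd (D.gh r) Λ)

/-- Polynomials in the ghosts and their jets, homogeneous of degree `i` and of ghost number `d`,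
with coefficients depending on the fields; `s`-stage ghosts have ghost number `s + 1`. -/
def ghostPoly (i d : ℕ) : Submodule ℝ (D.Alg U) :=
  Submodule.span ℝ {φ : D.Alg U | ∃ a : D.Alg U, a ∈ D.fieldFns U ∧
    ∃ l : List ((Σ s : Fin (D.N + 1), D.Gh s) × MIdx D.n), l.length = i ∧
      (l.map fun q => (q.1.1 : ℕ) + 1).sum = d ∧
      φ = a * (l.map fun q => (jetVar (D.gh q.1.2) q.2 : D.Alg U)).prod}

end FieldContent

open FieldContent

/-- Local data of a reducible Lagrangian gauge theory over a coordinate domain: a Lagrangian, its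
Noether identities and the coefficients of the linear parts of higher-stage ones. (Completeness of
the identities and the higher-stage identities themselves are not required.) -/
structure LocalTheory (D : FieldContent)
    (U : TopologicalSpace.Opens ((Fin D.n → ℝ) × (Fin D.m → ℝ))) where
  /-- The Lagrangian `L = ℒ d^n x`. -/
  L : D.Alg U
  L_field : L ∈ D.fieldFns U
  L_even : L ∈ parityPart 0
  /-- The coefficients `Δ_r^{A,Λ}` of the Noether identities. -/
  Δ₀ : D.Gh 0 → D.Fld → (MIdx D.n →₀ D.Alg U)
  Δ₀_field : ∀ r A Λ, Δ₀ r A Λ ∈ D.fieldFns U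
  Δ₀_parity : ∀ r A Λ, Δ₀ r A Λ ∈ parityPart (parity (D.gh r) + parity (D.fld A) + 1)
  /-- The Noether identities `∑ Δ_r^{A,Λ} d_Λ ℰ_A = 0`. -/
  noether : ∀ r, ∑ A, (Δ₀ r A).sum (fun Λ a => a * totalDs Λ (varD (D.fld A) L)) = 0
  /-- The coefficients `Δ_{r_{s+1}}^{r_s,Λ}` of the linear parts of the `(s+1)`-stage
  Noether identities. -/
  Δ : ∀ s : Fin D.N, D.Gh s.succ → D.Gh s.castSucc → (MIdx D.n →₀ D.Alg U)
  Δ_field : ∀ s r' r Λ, Δ s r' r Λ ∈ D.fieldFns U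
  Δ_parity : ∀ s r' r Λ,
    Δ s r' r Λ ∈ parityPart (parity (D.gh r') + parity (D.gh r) + 1)

namespace LocalTheory

variable {D : FieldContent} {U : TopologicalSpace.Opens ((Fin D.n → ℝ) × (Fin D.m → ℝ))}
  (T : LocalTheory D U)

/-- The coefficients `u_r^{A,Λ} = η(Δ_r^A)^Λ` of the gauge symmetry. -/
def uCoeff (r : D.Gh 0) (A : D.Fld) (Λ : MIdx D.n) : D.Alg U := adj (T.Δ₀ r A) Λ

/-- The components `u^A = ∑ c^r_Λ u_r^{A,Λ}` of the gauge symmetry. -/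
def u (A : D.Fld) : D.Alg U :=
  ∑ r : D.Gh 0, ∑ᶠ Λ : MIdx D.n, jetVar (D.gh r) Λ * T.uCoeff r A Λ

/-- The components `u^{r_s} = ∑ c^{r_{s+1}}_Λ η(Δ^{r_s}_{r_{s+1}})^Λ` of the `(s+1)`-stage gauge
symmetry, `0 ≤ s ≤ N - 1`. -/
def uStage (s : Fin D.N) (r : D.Gh s.castSucc) : D.Alg U :=
  ∑ r' : D.Gh s.succ, ∑ᶠ Λ : MIdx D.n, jetVar (D.gh r') Λ * adj (T.Δ s r' r) Λ

/-- The action of all higher-stage gauge symmetries on ghosts (zero on `N`-stage ghosts). -/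
def uHigher (s : Fin (D.N + 1)) : D.Gh s → D.Alg U :=
  Fin.lastCases (motive := fun s => D.Gh s → D.Alg U) (fun _ => 0) (fun s => T.uStage s) s

/-- The gauge symmetry `u = u^A ∂_A` as a graded derivation. -/
def uDer : D.Alg U → D.Alg U := prolong (onFields T.u)

/-- The components of the gauge operator `𝐮 = u + u^{(1)} + ⋯ + u^{(N)}`. -/
def gaugeOp : D.Var → D.Alg U := onFields T.u + onGhosts T.uHigher

/-- The components of the extension `𝐛 = 𝐮 + γ` of the gauge operator. -/
def brst (γ : ∀ s : Fin (D.N + 1), D.Gh s → D.Alg U) : D.Var → D.Alg U :=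
  T.gaugeOp + onGhosts γ

/-- The summand `γ^{(1)} = γ^r ∂/∂c^r` of `γ`, acting on `0`-stage ghosts. -/
def gamma1 (γ : ∀ s : Fin (D.N + 1), D.Gh s → D.Alg U) : D.Alg U → D.Alg U :=
  prolong (onGhosts fun s r => if s = 0 then γ s r else 0)

/-- The terms `γ` that extend the gauge operator: `γ^{(s+1)}`, acting on `s`-stage ghosts, is odd,
has ghost number `1` and is polynomial of degree at least `2` in ghosts. -/
structure IsExtensionTerm (γ : ∀ s : Fin (D.N + 1), D.Gh s → D.Alg U) : Prop where
  odd : ∀ (s : Fin (D.N + 1)) (r : D.Gh s), γ s r ∈ parityPart (parity (D.gh r) + 1)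
  poly : ∀ (s : Fin (D.N + 1)) (r : D.Gh s), γ s r ∈ ⨆ i : {i : ℕ // 2 ≤ i}, D.ghostPoly U i (s + 2)

/-- The vertical derivation `υ^A ∂_A` is a generalized gauge symmetry of the Lagrangian: a
variational symmetry that is given by a (polynomial, not necessarily linear) differential operator
in the `0`-stage ghosts. -/
structure IsGeneralizedGaugeSymmetry (υ : D.Fld → D.Alg U) : Prop where
  operator : ∀ A, υ A ∈ ⨆ i : ℕ, D.ghostPoly U i i
  symmetry : IsVariationalSymmetry T.L (onFields υ)

/-- The derivation `υ^A ∂_A` factorizes through the gauge symmetry `u` by putting `c^r = ζ^r`: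
`υ^A = ∑ d_Λ(ζ^r) u_r^{A,Λ}`. -/
def FactorizesBy (υ : D.Fld → D.Alg U) (ζ : D.Gh 0 → D.Alg U) : Prop :=
  ∀ A, υ A = ∑ r : D.Gh 0, ∑ᶠ Λ : MIdx D.n, totalDs Λ (ζ r) * T.uCoeff r A Λ

end LocalTheory

/-! ## Bundles of fields and ghosts over a manifold -/

/-- A composite bundle `F → Y → X` of even and odd fields, and graded vector bundles
`E_s = E_s^0 ⊕ E_s^1 → X` of ghosts, `0 ≤ s ≤ N`: a smooth fibre bundle `Y → X` with typical fibre
`Φ` over a smooth manifold `X`, a smooth vector bundle `F → Y` and smooth vector bundles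
`E_s^p → X`. -/
structure FieldBundle (D : FieldContent) where
  X : Type u
  [topX : TopologicalSpace X]
  [chartX : ChartedSpace (Fin D.n → ℝ) X]
  [manifoldX : IsManifold 𝓘(ℝ, Fin D.n → ℝ) ∞ X]
  [t2X : T2Space X]
  [sccX : SecondCountableTopology X]
  Y : Type v
  [topY : TopologicalSpace Y]
  [chartY : ChartedSpace ((Fin D.n → ℝ) × (Fin D.m → ℝ)) Y]
  [manifoldY : IsManifold 𝓘(ℝ, (Fin D.n → ℝ) × (Fin D.m → ℝ)) ∞ Y]
  Φ : Type v
  [topΦ : TopologicalSpace Φ]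
  [chartΦ : ChartedSpace (Fin D.m → ℝ) Φ]
  [manifoldΦ : IsManifold 𝓘(ℝ, Fin D.m → ℝ) ∞ Φ]
  [t2Φ : T2Space Φ]
  [sccΦ : SecondCountableTopology Φ]
  proj : Y → X
  locallyTrivial : ∀ x : X, ∃ e : Bundle.Trivialization Φ proj, x ∈ e.baseSet ∧
    ContMDiffOn 𝓘(ℝ, (Fin D.n → ℝ) × (Fin D.m → ℝ))
      (𝓘(ℝ, Fin D.n → ℝ).prod 𝓘(ℝ, Fin D.m → ℝ)) ∞ e e.source ∧
    ContMDiffOn (𝓘(ℝ, Fin D.n → ℝ).prod 𝓘(ℝ, Fin D.m → ℝ))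
      𝓘(ℝ, (Fin D.n → ℝ) × (Fin D.m → ℝ)) ∞ e.toOpenPartialHomeomorph.symm e.target
  F : Y → Type w
  [addF : ∀ y, AddCommGroup (F y)]
  [modF : ∀ y, Module ℝ (F y)]
  [topF : ∀ y, TopologicalSpace (F y)]
  [topTotF : TopologicalSpace (TotalSpace (Fin D.k → ℝ) F)]
  [fibreF : FiberBundle (Fin D.k → ℝ) F]
  [vectorF : VectorBundle ℝ (Fin D.k → ℝ) F]
  [smoothF : ContMDiffVectorBundle ∞ (Fin D.k → ℝ) F 𝓘(ℝ, (Fin D.n → ℝ) × (Fin D.m → ℝ))]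
  E : Fin (D.N + 1) → ZMod 2 → X → Type z
  [addE : ∀ s p x, AddCommGroup (E s p x)]
  [modE : ∀ s p x, Module ℝ (E s p x)]
  [topE : ∀ s p x, TopologicalSpace (E s p x)]
  [topTotE : ∀ s p, TopologicalSpace (TotalSpace (Fin (D.g s p) → ℝ) (E s p))]
  [fibreE : ∀ s p, FiberBundle (Fin (D.g s p) → ℝ) (E s p)]
  [vectorE : ∀ s p, VectorBundle ℝ (Fin (D.g s p) → ℝ) (E s p)]
  [smoothE : ∀ s p, ContMDiffVectorBundle ∞ (Fin (D.g s p) → ℝ) (E s p) 𝓘(ℝ, Fin D.n → ℝ)]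

namespace FieldBundle

attribute [instance] topX chartX manifoldX t2X sccX topY chartY manifoldY topΦ chartΦ manifoldΦ
  t2Φ sccΦ addF modF topF topTotF fibreF vectorF smoothF addE modE topE topTotE fibreE vectorE
  smoothE

variable {D : FieldContent} (B : FieldBundle.{u, v, w, z} D)

/-- Bundle coordinates: adapted charts `(x^λ)` of `X` and `(x^λ, y^i)` of `Y`, and local frames of
the vector bundles of odd fields and of ghosts. -/
structure Coords where
  base : OpenPartialHomeomorph B.X (Fin D.n → ℝ)
  base_mem : base ∈ IsManifold.maximalAtlas 𝓘(ℝ, Fin D.n → ℝ) ∞ B.X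
  total : OpenPartialHomeomorph B.Y ((Fin D.n → ℝ) × (Fin D.m → ℝ))
  total_mem : total ∈ IsManifold.maximalAtlas 𝓘(ℝ, (Fin D.n → ℝ) × (Fin D.m → ℝ)) ∞ B.Y
  proj_mem : ∀ y ∈ total.source, B.proj y ∈ base.source
  adapted : ∀ y ∈ total.source, (total y).1 = base (B.proj y)
  odd : Bundle.Trivialization (Fin D.k → ℝ)
    (TotalSpace.proj : TotalSpace (Fin D.k → ℝ) B.F → B.Y)
  odd_mem : MemTrivializationAtlas odd
  odd_source : total.source ⊆ odd.baseSet
  ghost : ∀ s p, Bundle.Trivialization (Fin (D.g s p) → ℝ)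
    (TotalSpace.proj : TotalSpace (Fin (D.g s p) → ℝ) (B.E s p) → B.X)
  ghost_mem : ∀ s p, MemTrivializationAtlas (ghost s p)
  ghost_source : ∀ s p, base.source ⊆ (ghost s p).baseSet

variable {B}

/-- The range of the coordinates `(x^λ, y^i)`. -/
def Coords.dom (κ : B.Coords) : TopologicalSpace.Opens ((Fin D.n → ℝ) × (Fin D.m → ℝ)) :=
  ⟨κ.total.target, κ.total.open_target⟩

/-- The algebra of graded functions in given bundle coordinates. -/
abbrev Coords.Alg (κ : B.Coords) := D.Alg κ.dom

variable (B)

/-- Local sections near `x ∈ X` on which graded functions are evaluated: a section of `Y`, `q`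
sections of `F` along it, a section of the even ghost bundles and `q` sections of the odd ones. -/
structure Probe (q : ℕ) (x : B.X) where
  body : B.X → B.Y
  body_smooth : ContMDiffAt 𝓘(ℝ, Fin D.n → ℝ) 𝓘(ℝ, (Fin D.n → ℝ) × (Fin D.m → ℝ)) ∞ body x
  body_section : ∀ᶠ x' in 𝓝 x, B.proj (body x') = x'
  odd : Fin q → ∀ x', B.F (body x')
  odd_smooth : ∀ j, ContMDiffAt 𝓘(ℝ, Fin D.n → ℝ)
    (𝓘(ℝ, (Fin D.n → ℝ) × (Fin D.m → ℝ)).prod 𝓘(ℝ, Fin D.k → ℝ)) ∞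
    (fun x' => (⟨body x', odd j x'⟩ : TotalSpace (Fin D.k → ℝ) B.F)) x
  evenGh : ∀ s x', B.E s 0 x'
  evenGh_smooth : ∀ s, ContMDiffAt 𝓘(ℝ, Fin D.n → ℝ)
    (𝓘(ℝ, Fin D.n → ℝ).prod 𝓘(ℝ, Fin (D.g s 0) → ℝ)) ∞
    (fun x' => (⟨x', evenGh s x'⟩ : TotalSpace (Fin (D.g s 0) → ℝ) (B.E s 0))) x
  oddGh : Fin q → ∀ s x', B.E s 1 x'
  oddGh_smooth : ∀ j s, ContMDiffAt 𝓘(ℝ, Fin D.n → ℝ)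
    (𝓘(ℝ, Fin D.n → ℝ).prod 𝓘(ℝ, Fin (D.g s 1) → ℝ)) ∞
    (fun x' => (⟨x', oddGh j s x'⟩ : TotalSpace (Fin (D.g s 1) → ℝ) (B.E s 1))) x

/-- The partial derivative `∂^Λ` of a function on `ℝ^n`. -/
def iterPD {n : ℕ} (Λ : MIdx n) (f : (Fin n → ℝ) → ℝ) : (Fin n → ℝ) → ℝ :=
  (List.finRange n).foldr
    (fun i h => (fun (h : (Fin n → ℝ) → ℝ) p => fderiv ℝ h p (Pi.single i 1))^[Λ i] h) f

variable {B} {q : ℕ} {x : B.X}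

/-- Coordinate expressions of the even components of a probe. -/
def Probe.evenExpr (c : B.Probe q x) (κ : B.Coords) : D.EVar → (Fin D.n → ℝ) → ℝ
  | .inl i => fun p => (κ.total (c.body (κ.base.symm p))).2 i
  | .inr r => fun p => (κ.ghost r.1 0 ⟨κ.base.symm p, c.evenGh r.1 (κ.base.symm p)⟩).2 r.2

/-- Coordinate expressions of the odd components of a probe. -/
def Probe.oddExpr (c : B.Probe q x) (κ : B.Coords) (j : Fin q) : D.OVar → (Fin D.n → ℝ) → ℝ
  | .inl a => fun p =>
      (κ.odd ⟨c.body (κ.base.symm p), c.odd j (κ.base.symm p)⟩).2 a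
  | .inr r => fun p =>
      (κ.ghost r.1 1 ⟨κ.base.symm p, c.oddGh j r.1 (κ.base.symm p)⟩).2 r.2

/-- The infinite jet at `x` of the even components of a probe. -/
def Probe.jet (c : B.Probe q x) (κ : B.Coords) (h : c.body x ∈ κ.total.source) :
    Jet (D.evenDom κ.dom) :=
  ⟨fun
    | .inl i => κ.base x i
    | .inr (e, Λ) => iterPD Λ (c.evenExpr κ e) (κ.base x), by
    have hs : B.proj (c.body x) = x := c.body_section.self_of_nhds
    have hx : x ∈ κ.base.source := hs ▸ κ.proj_mem _ h
    have h0 : ∀ f : (Fin D.n → ℝ) → ℝ, iterPD 0 f = f := by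
      intro f
      unfold iterPD
      induction List.finRange D.n with
      | nil => rfl
      | cons a l ih => exact ih
    have h1 : (κ.base x, fun i => (κ.total (c.body x)).2 i) = κ.total (c.body x) := by
      rw [← Prod.mk.eta (p := κ.total (c.body x)), κ.adapted _ h, hs]
    have h2 := κ.total.map_source h
    rw [← h1] at h2
    change ((fun i => κ.base x i),
      (fun i => iterPD 0 (c.evenExpr κ (Sum.inl i)) (κ.base x))) ∈ κ.total.target
    simp only [h0, Probe.evenExpr, κ.base.left_inv hx]
    exact h2⟩

/-- The value of a graded function on a probe: even jet coordinates are replaced with the jet of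
the even components, the odd one `c^a_Λ` with `∑_j ∂_Λ σ_j^a θ^j`, where `σ_j` are the odd
components and `θ^j` the generators of a Grassmann algebra. These values describe sections of the
exterior algebra bundles that graded functions are. -/
def Probe.eval (c : B.Probe q x) (κ : B.Coords) (h : c.body x ∈ κ.total.source) :
    κ.Alg →ₗ[ℝ] ExteriorAlgebra ℝ (Fin q → ℝ) :=
  (TensorProduct.lid ℝ _).toLinearMap ∘ₗ TensorProduct.map
    ((LinearMap.proj (c.jet κ h)).comp (SmoothFn (D.evenDom κ.dom)).toSubmodule.subtype)
    (ExteriorAlgebra.map (Finsupp.linearCombination ℝ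
      (fun a : D.OVar × MIdx D.n => fun j : Fin q =>
        iterPD a.2 (c.oddExpr κ j a.1) (κ.base x)))).toLinearMap

/-- Two coordinate expressions represent the same graded function on the overlap. -/
def Agree (κ κ' : B.Coords) (φ : κ.Alg) (φ' : κ'.Alg) : Prop :=
  ∀ (q : ℕ) (x : B.X) (c : B.Probe q x) (h : c.body x ∈ κ.total.source)
    (h' : c.body x ∈ κ'.total.source), c.eval κ h φ = c.eval κ' h' φ'

/-- Two coordinate expressions represent the same graded density `ℒ d^n x` on the overlap. -/
def AgreeDensity (κ κ' : B.Coords) (ℒ : κ.Alg) (ℒ' : κ'.Alg) : Prop :=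
  ∀ (q : ℕ) (x : B.X) (c : B.Probe q x) (h : c.body x ∈ κ.total.source)
    (h' : c.body x ∈ κ'.total.source), c.eval κ h ℒ =
      (fderiv ℝ (κ'.base ∘ κ.base.symm) (κ.base x)).det • c.eval κ' h' ℒ'

/-- A family of derivations, one for each system of bundle coordinates, is a globally defined
graded derivation: it respects the identification of graded functions on overlaps. -/
def IsGlobalDer (δ : ∀ κ : B.Coords, κ.Alg → κ.Alg) : Prop :=
  ∀ (κ κ' : B.Coords) (φ : κ.Alg) (φ' : κ'.Alg),
    Agree κ κ' φ φ' → Agree κ κ' (δ κ φ) (δ κ' φ')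

variable (B)

/-- A reducible Lagrangian gauge theory on `X`: its Lagrangian, Noether identities and higher-stage
Noether identities in all bundle coordinates. The Lagrangian is a global density, and the gauge
symmetry `u` and the gauge operator `𝐮` associated to the identities are global derivations. -/
structure GaugeTheory where
  loc : ∀ κ : B.Coords, LocalTheory D κ.dom
  lagrangian_global : ∀ κ κ' : B.Coords, AgreeDensity κ κ' (loc κ).L (loc κ').L
  symmetry_global : IsGlobalDer (B := B) fun κ => (loc κ).uDer
  gaugeOp_global : IsGlobalDer (B := B) fun κ => prolong (loc κ).gaugeOp

variable {B}

/-- `γ` provides a nilpotent (BRST) extension `𝐛 = 𝐮 + γ` of the gauge operator. -/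
structure GaugeTheory.IsNilpotentExtension (T : B.GaugeTheory)
    (γ : ∀ (κ : B.Coords) (s : Fin (D.N + 1)), D.Gh s → κ.Alg) : Prop where
  term : ∀ κ, LocalTheory.IsExtensionTerm (γ κ)
  isGlobal : IsGlobalDer (B := B) fun κ => prolong ((T.loc κ).brst (γ κ))
  nilpotent : ∀ κ, IsNilpotentDer (prolong ((T.loc κ).brst (γ κ)))

end FieldBundle

end GradedJet

end

noncomputable section

/-! Apply `𝐛 ∘ 𝐛 = 0` to a field `s^A`. Since `𝐛` sends `s^A` to `u^A`, the result is the sum of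
`u(u^A)`, of the higher-stage operators applied to `u^A`, and of `γ(u^A)`. Now `u^A` is linear in
the jets of the 0-stage ghosts, with coefficients in the fields. A derivation acting on ghosts only
kills these coefficients and commutes with total derivatives, so it merely replaces `c^r` in `u^A`
by its own component (`prolong_onGhosts_linOp`, `prolong_onGhosts_u`). In particular `γ(u^A) =
γ^{(1)}(u^A)`.

The three terms are then separated by their degree in ghosts, with the Euler derivation
`ghostCount`. The higher-stage term has degree 1. The term `u(u^A)` has degree 2, because `[N, u] =
u` for the counting derivation `N` (`ghostCount_uDer_u`). The term `γ^{(1)}(u^A)` has degree 2 as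
well: `γ^r` has ghost number 2 and degree at least 2, while every ghost has ghost number at least 1,
so its degree is exactly 2 and only 0-stage ghosts occur. Hence `u(u^A) = -γ^{(1)}(u^A)`
(`IsExtensionTerm.uDer_u`). As `u` is odd, `[u, u] = 2 u ∘ u`, and a bracket of prolongations is the
prolongation of its components (`prolong_bracket`), so the formula on fields gives the formula on
all graded functions.

The symmetry property is the converse direction of Noether's second theorem
(`isVariationalSymmetry_of_factorizesBy`). By the first variational formula, `υ(ℒ)` is `∑ υ^A ℰ_A`
up to a divergence. If `υ^A` comes from `u^A` by putting `c^r = ζ^r`, integration by parts turns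
this into `ζ^r` times the Noether identities, that is, zero. Divergences have vanishing variational
derivatives (`varD_totalDL`). Globality is inherited from `u` through the bracket formula.

All sign bookkeeping rests on the graded Leibniz rule `vf_mul` and the bracket formula `vf_bracket`
for derivations `∑ f_a ∂_a`. -/

namespace GradedJet


/-! ### Calculus of smooth functions of finite jet order. -/

section SmoothFunctions

variable {n : ℕ} {E : Type} {W : TopologicalSpace.Opens ((Fin n → ℝ) × (E → ℝ))}

theorem ext0_apply (f : Jet W → ℝ) (j : Jet W) : ext0 f j.1 = f j :=
  Subtype.val_injective.extend_apply f 0 j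

theorem ext0_mul (f f' : Jet W → ℝ) : ext0 (f * f') = ext0 f * ext0 f' := by
  funext a
  by_cases h : ∃ j : Jet W, j.1 = a
  · obtain ⟨j, rfl⟩ := h
    simp [ext0_apply]
  · simp only [ext0, Pi.mul_apply]
    rw [Function.extend_apply' _ _ _ h, Function.extend_apply' _ _ _ h,
      Function.extend_apply' _ _ _ h]
    simp

theorem partialD_mul (q : Coord n E) (f f' : SmoothFn W) :
    partialD q (f * f') = partialD q f * f' + f * partialD q f' := by
  classical
  apply Subtype.ext
  funext j
  have := deriv_mul (differentiableAt_ext0 f q j) (differentiableAt_ext0 f' q j)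
  change deriv (fun t => ext0 (f.1 * f'.1) _) _ = _
  simp only [ext0_mul]
  refine Eq.trans ?_ (this.trans ?_)
  · congr!
  · simp only [Function.update_eq_self, ext0_apply]
    change _ = deriv _ _ * f'.1 j + f.1 j * deriv _ _
    congr!

/-- Reduces partial derivatives on the infinite jet space to calculus on the finite-dimensional
space `S → ℝ`, with one representative `g` for all points. -/
theorem partialD_apply_of_eq [DecidableEq (Coord n E)] {f : SmoothFn W}
    {S : Finset (Coord n E)} {g : (S → ℝ) → ℝ}
    (hg : ∀ j : Jet W, f.1 j = g (fun q => j.1 q) ∧ ContDiffAt ℝ ∞ g (fun q => j.1 q))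
    (q : S) (j : Jet W) :
    (partialD q.1 f).1 j = fderiv ℝ g (fun q => j.1 q) (Pi.single q 1) := by
  have := (hasDerivAt_ext0 hg q.1 j).deriv
  simp only [q.2, dite_true] at this
  refine Eq.trans ?_ (this.trans ?_)
  · change deriv _ _ = deriv _ _
    congr!
  · congr!

theorem partialD_eq_zero_of_notMem {f : SmoothFn W} {S : Finset (Coord n E)} {g : (S → ℝ) → ℝ}
    (hg : ∀ j : Jet W, f.1 j = g (fun q => j.1 q) ∧ ContDiffAt ℝ ∞ g (fun q => j.1 q))
    {q : Coord n E} (hq : q ∉ S) : partialD q f = 0 := by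
  classical
  apply Subtype.ext
  funext j
  have := (hasDerivAt_ext0 hg q j).deriv
  simp only [hq, dite_false] at this
  refine Eq.trans ?_ this
  change deriv _ _ = deriv _ _
  congr!

theorem finite_partialD_ne_zero (f : SmoothFn W) : {q | partialD q f ≠ 0}.Finite := by
  obtain ⟨S, g, hg⟩ := f.2
  refine S.finite_toSet.subset fun q hq => ?_
  by_contra h
  exact hq (partialD_eq_zero_of_notMem hg h)

/-- Both sides are values of the second Fréchet derivative of one representative `g`, which is
symmetric. If one of the coordinates is not in `S`, both sides vanish. -/
theorem partialD_comm (q q' : Coord n E) (f : SmoothFn W) :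
    partialD q (partialD q' f) = partialD q' (partialD q f) := by
  classical
  obtain ⟨S, g, hg⟩ := f.2
  by_cases hq : q ∈ S
  swap
  · obtain hz := partialD_eq_zero_of_notMem hg hq
    rw [hz, map_zero]
    by_cases hq' : q' ∈ S
    -- The derivative of `f` is represented over the same set `S`, so a coordinate outside `S`
    -- annihilates it too.
    · refine partialD_eq_zero_of_notMem (S := S)
        (g := fun v => fderiv ℝ g v (Pi.single ⟨q', hq'⟩ 1))
        (fun j => ⟨partialD_apply_of_eq hg ⟨q', hq'⟩ j, ?_⟩) hq
      exact ((hg j).2.fderiv_right (m := ∞) (by simp)).clm_apply contDiffAt_const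
    · rw [partialD_eq_zero_of_notMem hg hq', map_zero]
  by_cases hq' : q' ∈ S
  swap
  · rw [partialD_eq_zero_of_notMem hg hq', map_zero]
    refine (partialD_eq_zero_of_notMem (S := S)
      (g := fun v => fderiv ℝ g v (Pi.single ⟨q, hq⟩ 1))
      (fun j => ⟨partialD_apply_of_eq hg ⟨q, hq⟩ j, ?_⟩) hq').symm
    exact ((hg j).2.fderiv_right (m := ∞) (by simp)).clm_apply contDiffAt_const
  have key : ∀ (a b : S) (j : Jet W), (partialD a.1 (partialD b.1 f)).1 j =
      fderiv ℝ (fderiv ℝ g) (fun q => j.1 q) (Pi.single a 1) (Pi.single b 1) := by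
    intro a b j
    rw [partialD_apply_of_eq (f := partialD b.1 f) (S := S)
        (g := fun v => fderiv ℝ g v (Pi.single b 1))
      (fun j => ⟨partialD_apply_of_eq hg b j,
        ((hg j).2.fderiv_right (m := ∞) (by simp)).clm_apply contDiffAt_const⟩) a j]
    have hd : DifferentiableAt ℝ (fderiv ℝ g) (fun q : S => j.1 q) :=
      ((hg j).2.fderiv_right (m := ∞) (by simp)).differentiableAt (by simp)
    rw [fderiv_clm_apply hd (differentiableAt_const _)]
    simp
  apply Subtype.ext
  funext j
  refine (key ⟨q, hq⟩ ⟨q', hq'⟩ j).trans (Eq.trans ?_ (key ⟨q', hq'⟩ ⟨q, hq⟩ j).symm)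
  exact ((hg j).2.isSymmSndFDerivAt (by
    rw [minSmoothness_of_isRCLikeNormedField]
    exact WithTop.coe_le_coe.2 (show (2 : ℕ∞) ≤ ⊤ from le_top))).eq _ _

/-- A coordinate as a smooth function on the jet space. -/
def coordFn (q : Coord n E) : SmoothFn W := ⟨fun j => j.1 q, isSmoothFn_coord q⟩

theorem partialD_coordFn [DecidableEq (Coord n E)] (q q' : Coord n E) :
    partialD q (coordFn q' : SmoothFn W) = if q = q' then 1 else 0 := by
  classical
  have hg : ∀ j : Jet W, (coordFn q' : SmoothFn W).1 j =
      (fun v : (({q'} : Finset _) → ℝ) => v ⟨q', Finset.mem_singleton_self q'⟩) (fun q => j.1 q) ∧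
      ContDiffAt ℝ ∞ (fun v : (({q'} : Finset _) → ℝ) => v ⟨q', Finset.mem_singleton_self q'⟩)
        (fun q => j.1 q) := fun j => ⟨rfl, by fun_prop⟩
  split_ifs with h
  · subst h
    apply Subtype.ext
    funext j
    rw [partialD_apply_of_eq (S := {q})
      (g := fun v => v ⟨q, Finset.mem_singleton_self q⟩) hg ⟨q, Finset.mem_singleton_self q⟩ j]
    rw [fderiv_apply (by fun_prop)]
    simp
  · exact partialD_eq_zero_of_notMem (S := {q'})
      (g := fun v => v ⟨q', Finset.mem_singleton_self q'⟩) hg (by simpa using h)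

end SmoothFunctions

/-! ### Contractions and signs in the exterior algebra. -/

section OddAlgebra

variable {M : Type*} [AddCommGroup M] [Module ℝ M]

open CliffordAlgebra in
-- Contraction is an antiderivation. Writing the sign through `involute` makes the rule valid for
-- inhomogeneous `x`.
theorem contractLeft_mul (d : Module.Dual ℝ M) (x y : ExteriorAlgebra ℝ M) :
    contractLeft d (x * y) = contractLeft d x * y + involute x * contractLeft d y := by
  induction x using CliffordAlgebra.left_induction with
  | algebraMap r =>
    rw [contractLeft_algebraMap_mul, contractLeft_algebraMap, AlgHom.commutes, zero_mul, zero_add]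
  | add x x' hx hx' =>
    simp only [add_mul, map_add, hx, hx']
    abel
  | ι_mul x v hx =>
    rw [mul_assoc, contractLeft_ι_mul, hx, contractLeft_ι_mul, map_mul, involute_ι]
    simp only [mul_add, sub_mul, smul_mul_assoc, mul_assoc, neg_mul]
    abel

open CliffordAlgebra in
theorem contractLeft_involute (d : Module.Dual ℝ M) (x : ExteriorAlgebra ℝ M) :
    contractLeft d (involute x) = - involute (contractLeft d x) := by
  induction x using CliffordAlgebra.left_induction with
  | algebraMap r => simp [contractLeft_algebraMap]
  | add x x' hx hx' => simp only [map_add, hx, hx', neg_add]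
  | ι_mul x v hx =>
    simp only [map_mul, involute_ι, contractLeft_ι_mul, map_sub, map_smul, neg_mul, map_neg, hx]
    simp

open CliffordAlgebra in
theorem ι_mul_eq_involute_mul_ι (v : M) (y : ExteriorAlgebra ℝ M) :
    ExteriorAlgebra.ι ℝ v * y = involute y * ExteriorAlgebra.ι ℝ v := by
  induction y using CliffordAlgebra.left_induction with
  | algebraMap r => rw [AlgHom.commutes]; exact (Algebra.commutes r _).symm
  | add x x' hx hx' => simp only [map_add, mul_add, add_mul, hx, hx']
  | ι_mul x w hx =>
    have h : ExteriorAlgebra.ι ℝ v * ExteriorAlgebra.ι ℝ w =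
        - (ExteriorAlgebra.ι ℝ w * ExteriorAlgebra.ι ℝ v) :=
      eq_neg_of_add_eq_zero_left (ExteriorAlgebra.ι_add_mul_swap v w)
    rw [map_mul, involute_ι, ← mul_assoc]
    change ExteriorAlgebra.ι ℝ v * ExteriorAlgebra.ι ℝ w * x = _
    rw [h, neg_mul, mul_assoc, hx, neg_mul, neg_mul, mul_assoc]

open CliffordAlgebra in
-- Here `x + involute x` and `x - involute x` are twice the even and the odd part of `x`. The even
-- part commutes with `y`, and the odd part passes `y` at the cost of the involution. This is graded
-- commutativity without any homogeneity assumption.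
theorem two_smul_mul_eq (x y : ExteriorAlgebra ℝ M) :
    (2 : ℝ) • (x * y) = y * (x + involute x) + involute y * (x - involute x) := by
  induction x using CliffordAlgebra.left_induction generalizing y with
  | algebraMap r =>
    rw [AlgHom.commutes, sub_self, mul_zero, add_zero, ← two_smul ℝ, mul_smul_comm,
      Algebra.commutes]
  | add x x' hx hx' =>
    simp only [add_mul, smul_add, hx, hx', map_add, mul_add, mul_sub]
    abel
  | ι_mul x v hx =>
    have hι : ∀ z, ι (0 : QuadraticForm ℝ M) v * z = involute z * ι (0 : QuadraticForm ℝ M) v :=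
      ι_mul_eq_involute_mul_ι v
    rw [mul_assoc, ← mul_smul_comm, hx, mul_add, ← mul_assoc, ← mul_assoc, hι y, hι (involute y),
      involute_involute, map_mul, involute_ι]
    simp only [mul_add, mul_sub, mul_assoc, neg_mul, sub_neg_eq_add, mul_neg]
    abel

open CliffordAlgebra in
theorem finite_contractLeft_ne_zero {κ : Type*} (x : ExteriorAlgebra ℝ (κ →₀ ℝ)) :
    {a : κ | contractLeft (Finsupp.lapply (R := ℝ) a) x ≠ 0}.Finite := by
  induction x using CliffordAlgebra.left_induction with
  | algebraMap r => simp [contractLeft_algebraMap]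
  | add x x' hx hx' =>
    refine (hx.union hx').subset fun a ha => ?_
    by_contra h
    simp only [Set.mem_union, Set.mem_ofPred_eq, not_or, not_not] at h
    exact ha (by rw [map_add, h.1, h.2, add_zero])
  | ι_mul x v hx =>
    refine (v.support.finite_toSet.union hx).subset fun a ha => ?_
    by_contra h
    simp only [Set.mem_union, Set.mem_ofPred_eq, not_or, not_not, Finset.mem_coe,
      Finsupp.mem_support_iff] at h
    exact ha (by rw [contractLeft_ι_mul, h.2]; simp [h.1])

end OddAlgebra


/-! ### Signs -/

/-- The sign `(-1)^p`. -/
def sgn (p : ZMod 2) : ℝ := if p = 0 then 1 else -1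

@[simp] theorem sgn_zero : sgn 0 = 1 := by simp [sgn]

@[simp] theorem sgn_one : sgn 1 = -1 := by simp [sgn]

theorem zmod_two_cases (p : ZMod 2) : p = 0 ∨ p = 1 := by
  revert p; decide

theorem sgn_add (p q : ZMod 2) : sgn (p + q) = sgn p * sgn q := by
  rcases zmod_two_cases p with rfl | rfl <;> rcases zmod_two_cases q with rfl | rfl <;>
    simp [show (1 + 1 : ZMod 2) = 0 from rfl]

theorem sgn_mul_self (p : ZMod 2) : sgn p * sgn p = 1 := by
  rcases zmod_two_cases p with rfl | rfl <;> simp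

/-! ### The algebra of graded functions: parity, graded commutativity, partial derivatives. -/

section GradedAlgebra

variable {n : ℕ} {E O : Type} {W : TopologicalSpace.Opens ((Fin n → ℝ) × (E → ℝ))}

instance : Ring (JetAlg O W) := inferInstance

instance : AddCommGroup (JetAlg O W) := inferInstance

instance : Module ℝ (JetAlg O W) := inferInstance

instance : AddGroup (JetAlg O W) := inferInstance

instance : NonUnitalNonAssocRing (JetAlg O W) := inferInstance

instance : SMulZeroClass ℝ (JetAlg O W) := inferInstance

/-! ### Parity of graded functions -/

/-- The grade involution of the algebra of graded functions. -/
def gradeInv : JetAlg O W →ₐ[ℝ] JetAlg O W :=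
  Algebra.TensorProduct.map (AlgHom.id ℝ _) CliffordAlgebra.involute

@[simp] theorem gradeInv_tmul (f : SmoothFn W) (x : OddAlg n O) :
    gradeInv (f ⊗ₜ[ℝ] x : JetAlg O W) = f ⊗ₜ CliffordAlgebra.involute x := rfl

@[simp] theorem gradeInv_gradeInv (φ : JetAlg O W) : gradeInv (gradeInv φ) = φ := by
  induction φ using TensorProduct.induction_on with
  | zero => simp
  | tmul f x => simp
  | add φ ψ h h' => simp only [map_add, h, h']

/-- The `p`-th power of the grade involution. -/
def gradeInvPow (p : ZMod 2) : JetAlg O W →ₐ[ℝ] JetAlg O W :=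
  if p = 0 then AlgHom.id ℝ _ else gradeInv

@[simp] theorem gradeInvPow_zero (φ : JetAlg O W) : gradeInvPow 0 φ = φ := by simp [gradeInvPow]

@[simp] theorem gradeInvPow_one : (gradeInvPow 1 : JetAlg O W →ₐ[ℝ] JetAlg O W) = gradeInv := by
  simp [gradeInvPow]

theorem gradeInvPow_gradeInvPow (p q : ZMod 2) (φ : JetAlg O W) :
    gradeInvPow p (gradeInvPow q φ) = gradeInvPow (p + q) φ := by
  rcases zmod_two_cases p with rfl | rfl <;> rcases zmod_two_cases q with rfl | rfl <;>
    simp [show (1 + 1 : ZMod 2) = 0 from rfl]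

/-- The graded function `φ` has Grassmann parity `p`. -/
def HasParity (p : ZMod 2) (φ : JetAlg O W) : Prop := gradeInv φ = sgn p • φ

theorem HasParity.gradeInvPow_eq {p : ZMod 2} {φ : JetAlg O W} (h : HasParity p φ) (q : ZMod 2) :
    gradeInvPow q φ = sgn (q * p) • φ := by
  rcases zmod_two_cases q with rfl | rfl
  · simp
  · rw [gradeInvPow_one, one_mul]
    exact h

theorem hasParity_zero (p : ZMod 2) : HasParity p (0 : JetAlg O W) := by simp [HasParity]

theorem hasParity_one : HasParity 0 (1 : JetAlg O W) := by simp [HasParity]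

theorem HasParity.add {p : ZMod 2} {φ ψ : JetAlg O W} (h : HasParity p φ) (h' : HasParity p ψ) :
    HasParity p (φ + ψ) := by
  unfold HasParity at *
  rw [map_add, h, h', smul_add]

theorem HasParity.smul {p : ZMod 2} {φ : JetAlg O W} (c : ℝ) (h : HasParity p φ) :
    HasParity p (c • φ) := by
  unfold HasParity at *
  rw [map_smul, h, smul_comm]

theorem hasParity_sum {ι : Type*} {p : ZMod 2} {s : Finset ι} {φ : ι → JetAlg O W}
    (h : ∀ i ∈ s, HasParity p (φ i)) : HasParity p (∑ i ∈ s, φ i) :=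
  Finset.sum_induction _ _ (fun _ _ => HasParity.add) (hasParity_zero p) h

theorem hasParity_finsum {ι : Type*} {p : ZMod 2} {φ : ι → JetAlg O W}
    (h : ∀ i, HasParity p (φ i)) : HasParity p (∑ᶠ i, φ i) := by
  exact finsum_induction _ (hasParity_zero p) (fun _ _ => HasParity.add) h

theorem HasParity.mul {p q : ZMod 2} {φ ψ : JetAlg O W} (h : HasParity p φ) (h' : HasParity q ψ) :
    HasParity (p + q) (φ * ψ) := by
  unfold HasParity at *
  rw [map_mul, h, h', sgn_add, smul_mul_smul_comm]

/-- Passes from the parity submodules to eigenvectors of `gradeInv`, a form preserved by products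
and derivations through short sign computations. -/
theorem hasParity_of_mem_parityPart {p : ZMod 2} {φ : JetAlg O W} (h : φ ∈ parityPart p) :
    HasParity p φ := by
  obtain ⟨t, rfl⟩ := h
  unfold HasParity
  induction t using TensorProduct.induction_on with
  | zero => simp
  | tmul f x =>
    rw [LinearMap.lTensor_tmul, gradeInv_tmul, ← TensorProduct.tmul_smul]
    congr 1
    rcases zmod_two_cases p with rfl | rfl
    · simpa using CliffordAlgebra.involute_eq_of_mem_even x.2
    · simpa using CliffordAlgebra.involute_eq_of_mem_odd x.2
  | add a b ha hb => simp only [map_add, ha, hb, smul_add]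

theorem two_smul_mul_eq_gradeInv (φ ψ : JetAlg O W) :
    (2 : ℝ) • (φ * ψ) = ψ * (φ + gradeInv φ) + gradeInv ψ * (φ - gradeInv φ) := by
  induction φ using TensorProduct.induction_on with
  | zero => simp
  | add φ φ' h h' =>
    simp only [add_mul, smul_add, h, h', map_add, mul_add, mul_sub]
    abel
  | tmul f x =>
    induction ψ using TensorProduct.induction_on with
    | zero => simp
    | add ψ ψ' h h' =>
      simp only [mul_add, smul_add, h, h', map_add, add_mul]
      abel
    | tmul g y =>
      simp only [gradeInv_tmul, ← TensorProduct.tmul_add, ← TensorProduct.tmul_sub,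
        Algebra.TensorProduct.tmul_mul_tmul, ← TensorProduct.tmul_smul, mul_comm g f]
      rw [two_smul_mul_eq]

/-- Graded commutativity, with a homogeneous left factor. -/
theorem HasParity.mul_eq {p : ZMod 2} {φ : JetAlg O W} (h : HasParity p φ) (ψ : JetAlg O W) :
    φ * ψ = gradeInvPow p ψ * φ := by
  have key := two_smul_mul_eq_gradeInv φ ψ
  have h2 : (2 : ℝ) ≠ 0 := two_ne_zero
  apply smul_right_injective _ h2
  change (2 : ℝ) • (φ * ψ) = (2 : ℝ) • _
  rw [key]
  unfold HasParity at h
  rcases zmod_two_cases p with rfl | rfl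
  · simp only [sgn_zero, one_smul] at h
    rw [h, sub_self, mul_zero, add_zero, ← two_smul ℝ, mul_smul_comm, gradeInvPow_zero]
  · simp only [sgn_one, neg_smul, one_smul] at h
    rw [h, add_neg_cancel, mul_zero, zero_add, sub_neg_eq_add, ← two_smul ℝ, mul_smul_comm,
      gradeInvPow_one]

theorem HasParity.mul_comm {p q : ZMod 2} {φ ψ : JetAlg O W} (h : HasParity p φ)
    (h' : HasParity q ψ) : φ * ψ = sgn (p * q) • (ψ * φ) := by
  rw [h.mul_eq, h'.gradeInvPow_eq, smul_mul_assoc]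

/-! ### Partial derivatives -/

/-- Indices of all coordinates: the base coordinates and the jets of all variables. -/
abbrev Crd (n : ℕ) (E O : Type) := Fin n ⊕ ((E ⊕ O) × MIdx n)

/-- The Grassmann parity of a coordinate. -/
def crdParity : Crd n E O → ZMod 2
  | .inl _ => 0
  | .inr a => parity a.1

/-- The partial derivative with respect to a coordinate. -/
def del : Crd n E O → (JetAlg O W →ₗ[ℝ] JetAlg O W)
  | .inl i => pdx i
  | .inr a => pd a.1 a.2

theorem rTensor_partialD_mul (q : Coord n E) (φ ψ : JetAlg O W) :
    LinearMap.rTensor (OddAlg n O) (partialD (W := W) q) (φ * ψ) =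
      LinearMap.rTensor (OddAlg n O) (partialD q) φ * ψ +
        φ * LinearMap.rTensor (OddAlg n O) (partialD q) ψ := by
  induction φ using TensorProduct.induction_on with
  | zero => simp
  | add φ φ' h h' => simp only [add_mul, map_add, h, h']; abel
  | tmul f x =>
    induction ψ using TensorProduct.induction_on with
    | zero => simp
    | add ψ ψ' h h' => simp only [mul_add, map_add, h, h']; abel
    | tmul g y =>
      simp only [Algebra.TensorProduct.tmul_mul_tmul, LinearMap.rTensor_tmul, partialD_mul,
        TensorProduct.add_tmul]

theorem lTensor_contractLeft_mul (d : Module.Dual ℝ ((O × MIdx n) →₀ ℝ)) (φ ψ : JetAlg O W) :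
    LinearMap.lTensor (SmoothFn W) (CliffordAlgebra.contractLeft d) (φ * ψ) =
      LinearMap.lTensor (SmoothFn W) (CliffordAlgebra.contractLeft d) φ * ψ +
        gradeInv φ * LinearMap.lTensor (SmoothFn W) (CliffordAlgebra.contractLeft d) ψ := by
  induction φ using TensorProduct.induction_on with
  | zero => simp
  | add φ φ' h h' => simp only [add_mul, map_add, h, h']; abel
  | tmul f x =>
    induction ψ using TensorProduct.induction_on with
    | zero => simp
    | add ψ ψ' h h' => simp only [mul_add, map_add, h, h']; abel
    | tmul g y =>
      simp only [Algebra.TensorProduct.tmul_mul_tmul, LinearMap.lTensor_tmul, gradeInv_tmul,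
        ← TensorProduct.tmul_add]
      rw [contractLeft_mul]

/-- The graded Leibniz rule for partial derivatives. -/
theorem del_mul (a : Crd n E O) (φ ψ : JetAlg O W) :
    del a (φ * ψ) = del a φ * ψ + gradeInvPow (crdParity a) φ * del a ψ := by
  rcases a with i | ⟨e | o, Λ⟩
  · simp only [crdParity, gradeInvPow_zero]
    exact rTensor_partialD_mul (.inl i) φ ψ
  · simp only [crdParity, parity, gradeInvPow_zero]
    exact rTensor_partialD_mul (.inr (e, Λ)) φ ψ
  · simp only [crdParity, parity, gradeInvPow_one]
    exact lTensor_contractLeft_mul (Finsupp.lapply (o, Λ)) φ ψ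

theorem del_gradeInv (a : Crd n E O) (φ : JetAlg O W) :
    del a (gradeInv φ) = sgn (crdParity a) • gradeInv (del a φ) := by
  induction φ using TensorProduct.induction_on with
  | zero => simp
  | add φ φ' h h' => simp only [map_add, h, h', smul_add]
  | tmul f x =>
    rcases a with i | ⟨e | o, Λ⟩
    · simp [del, pdx, crdParity]
    · simp [del, pd, crdParity, parity]
    · simp only [del, pd, crdParity, parity, gradeInv_tmul, LinearMap.lTensor_tmul,
        contractLeft_involute, sgn_one, neg_smul, one_smul, TensorProduct.tmul_neg]

theorem HasParity.pderiv {p : ZMod 2} {φ : JetAlg O W} (h : HasParity p φ) (a : Crd n E O) :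
    HasParity (p + crdParity a) (del a φ) := by
  have := del_gradeInv a φ
  unfold HasParity at *
  rw [h, map_smul] at this
  rw [sgn_add, _root_.mul_comm, mul_smul, this, smul_smul, sgn_mul_self, one_smul]

theorem del_one (a : Crd n E O) : del a (1 : JetAlg O W) = 0 := by
  have := del_mul a (1 : JetAlg O W) 1
  rw [mul_one, mul_one, map_one (gradeInvPow _), one_mul] at this
  exact left_eq_add.1 this

theorem rTensor_partialD_comm (q q' : Coord n E) (φ : JetAlg O W) :
    LinearMap.rTensor (OddAlg n O) (partialD (W := W) q)
      (LinearMap.rTensor (OddAlg n O) (partialD q') φ) =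
      LinearMap.rTensor (OddAlg n O) (partialD (W := W) q')
        (LinearMap.rTensor (OddAlg n O) (partialD q) φ) := by
  induction φ using TensorProduct.induction_on with
  | zero => simp
  | add φ φ' h h' => simp only [map_add, h, h']
  | tmul f x => simp only [LinearMap.rTensor_tmul, partialD_comm q q']

theorem rTensor_lTensor_comm (f : SmoothFn W →ₗ[ℝ] SmoothFn W)
    (g : OddAlg n O →ₗ[ℝ] OddAlg n O) (φ : JetAlg O W) :
    LinearMap.rTensor (OddAlg n O) f (LinearMap.lTensor (SmoothFn W) g φ) =
      LinearMap.lTensor (SmoothFn W) g (LinearMap.rTensor (OddAlg n O) f φ) := by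
  induction φ using TensorProduct.induction_on with
  | zero => simp
  | add φ φ' h h' => simp only [map_add, h, h']
  | tmul f x => simp only [LinearMap.rTensor_tmul, LinearMap.lTensor_tmul]

theorem lTensor_contractLeft_comm (d d' : Module.Dual ℝ ((O × MIdx n) →₀ ℝ)) (φ : JetAlg O W) :
    LinearMap.lTensor (SmoothFn W) (CliffordAlgebra.contractLeft d)
      (LinearMap.lTensor (SmoothFn W) (CliffordAlgebra.contractLeft d') φ) =
      (-1 : ℝ) • LinearMap.lTensor (SmoothFn W) (CliffordAlgebra.contractLeft d')
        (LinearMap.lTensor (SmoothFn W) (CliffordAlgebra.contractLeft d) φ) := by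
  induction φ using TensorProduct.induction_on with
  | zero => simp
  | add φ φ' h h' => simp only [map_add, h, h', smul_add]
  | tmul f x =>
    simp only [LinearMap.lTensor_tmul]
    rw [CliffordAlgebra.contractLeft_comm, TensorProduct.tmul_neg, neg_one_smul]

/-- Graded commutativity of partial derivatives. -/
theorem del_comm (a b : Crd n E O) (φ : JetAlg O W) :
    del a (del b φ) = sgn (crdParity a * crdParity b) • del b (del a φ) := by
  rcases a with i | ⟨e | o, Λ⟩ <;> rcases b with j | ⟨e' | o', Λ'⟩ <;>
    simp only [crdParity, parity, mul_zero, mul_one, sgn_zero, sgn_one, one_smul]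
  · exact rTensor_partialD_comm _ _ φ
  · exact rTensor_partialD_comm _ _ φ
  · exact rTensor_lTensor_comm _ _ φ
  · exact rTensor_partialD_comm _ _ φ
  · exact rTensor_partialD_comm _ _ φ
  · exact rTensor_lTensor_comm _ _ φ
  · exact (rTensor_lTensor_comm _ _ φ).symm
  · exact (rTensor_lTensor_comm _ _ φ).symm
  · exact lTensor_contractLeft_comm _ _ φ

/-- A graded function depends on finitely many coordinates. Hence the `finsum`s defining total
derivatives, prolongations and variational derivatives are genuine finite sums, rather than the
default value zero. -/
theorem finite_del_ne_zero (φ : JetAlg O W) : {a : Crd n E O | del a φ ≠ 0}.Finite := by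
  induction φ using TensorProduct.induction_on with
  | zero => simp
  | add φ φ' h h' =>
    refine (h.union h').subset fun a ha => ?_
    by_contra hn
    simp only [Set.mem_union, Set.mem_ofPred_eq, not_or, not_not] at hn
    exact ha (by rw [map_add, hn.1, hn.2, add_zero])
  | tmul f x =>
    have hf : (Set.range fun q : {q : Coord n E | partialD q f ≠ 0} =>
        (Sum.map id (Prod.map Sum.inl id) q.1 : Crd n E O)).Finite :=
      haveI := (finite_partialD_ne_zero f).to_subtype
      Set.finite_range _
    have hx : (Set.range fun q : {q : O × MIdx n |
        CliffordAlgebra.contractLeft (Finsupp.lapply (R := ℝ) q) x ≠ 0} =>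
        (Sum.inr (Sum.inr q.1.1, q.1.2) : Crd n E O)).Finite :=
      haveI := (finite_contractLeft_ne_zero x).to_subtype
      Set.finite_range _
    refine (hf.union hx).subset fun a ha => ?_
    rcases a with i | ⟨e | o, Λ⟩
    · refine Or.inl ⟨⟨.inl i, fun h => ha ?_⟩, rfl⟩
      simp [del, pdx, h]
    · refine Or.inl ⟨⟨.inr (e, Λ), fun h => ha ?_⟩, rfl⟩
      simp [del, pd, h]
    · refine Or.inr ⟨⟨(o, Λ), fun h => ha ?_⟩, rfl⟩
      simp [del, pd, h]

theorem hasParity_jetVar (A : E ⊕ O) (Λ : MIdx n) :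
    HasParity (parity A) (jetVar A Λ : JetAlg O W) := by
  rcases A with e | o
  · simp [HasParity, jetVar, parity]
  · simp [HasParity, jetVar, parity, ExteriorAlgebra.ι, TensorProduct.tmul_neg]

open Classical in
theorem del_jetVar (a : Crd n E O) (A : E ⊕ O) (Λ : MIdx n) :
    del a (jetVar A Λ : JetAlg O W) = if a = .inr (A, Λ) then 1 else 0 := by
  rcases A with e | o
  · change del a (coordFn (.inr (e, Λ)) ⊗ₜ[ℝ] 1) = _
    rcases a with i | ⟨e' | o', Λ'⟩
    · simp [del, pdx, partialD_coordFn]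
    · simp only [del, pd, LinearMap.rTensor_tmul, partialD_coordFn]
      simp [Prod.ext_iff, ite_and, Algebra.TensorProduct.one_def, apply_ite]
      split_ifs <;> simp
    · simp [del, pd]
  · rcases a with i | ⟨e' | o', Λ'⟩
    · have : partialD (W := W) (.inl i) 1 = 0 := by
        have := partialD_mul (W := W) (.inl i) 1 1
        simpa using this
      simp [del, pdx, jetVar, this]
    · have : partialD (W := W) (.inr (e', Λ')) 1 = 0 := by
        have := partialD_mul (W := W) (.inr (e', Λ')) 1 1
        simpa using this
      simp [del, pd, jetVar, this]
    · simp only [del, pd, jetVar, LinearMap.lTensor_tmul]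
      have : CliffordAlgebra.contractLeft (Finsupp.lapply (R := ℝ) (o', Λ'))
          (ExteriorAlgebra.ι ℝ (Finsupp.single (o, Λ) (1 : ℝ))) =
          algebraMap ℝ (OddAlg n O) ((Finsupp.single (o, Λ) (1 : ℝ)) (o', Λ')) :=
        CliffordAlgebra.contractLeft_ι 0 (d := Finsupp.lapply (R := ℝ) (o', Λ'))
          (Finsupp.single (o, Λ) 1)
      rw [this, Finsupp.single_apply]
      simp only [Sum.inr.injEq, Prod.mk.injEq, eq_comm, Algebra.TensorProduct.one_def]
      split_ifs <;> simp

end GradedAlgebra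


/-! ### Graded derivations of the jet algebra and their brackets. -/

section GradedDerivations

variable {n : ℕ} {E O : Type} {W : TopologicalSpace.Opens ((Fin n → ℝ) × (E → ℝ))}

/-! ### Graded derivations with given components -/

theorem finite_support_mul_del (f : Crd n E O → JetAlg O W) (φ : JetAlg O W) :
    (Function.support fun a => f a * del a φ).Finite :=
  (finite_del_ne_zero φ).subset fun a ha h => ha (by simp only [h, mul_zero])

/-- The graded derivation `∑ f_a ∂_a`, the sum running over all coordinates. -/
def vf (f : Crd n E O → JetAlg O W) : JetAlg O W →ₗ[ℝ] JetAlg O W where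
  toFun φ := ∑ᶠ a, f a * del a φ
  map_add' φ ψ := by
    simp only [map_add, mul_add]
    exact finsum_add_distrib (finite_support_mul_del f φ) (finite_support_mul_del f ψ)
  map_smul' c φ := by
    simp only [map_smul, mul_smul_comm, RingHom.id_apply]
    exact (smul_finsum' c (finite_support_mul_del f φ)).symm

theorem vf_apply (f : Crd n E O → JetAlg O W) (φ : JetAlg O W) :
    vf f φ = ∑ᶠ a, f a * del a φ := rfl

theorem vf_eq_sum (f : Crd n E O → JetAlg O W) {φ : JetAlg O W} {S : Finset (Crd n E O)}
    (hS : ∀ a ∉ S, del a φ = 0) : vf f φ = ∑ a ∈ S, f a * del a φ := by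
  refine finsum_eq_sum_of_support_subset _ fun a ha => ?_
  by_contra h
  exact ha (by simp only [hS a h, mul_zero])

theorem exists_finset_del_eq_zero (φ : JetAlg O W) :
    ∃ S : Finset (Crd n E O), ∀ a ∉ S, del a φ = 0 :=
  ⟨(finite_del_ne_zero φ).toFinset, fun a ha => by
    rwa [Set.Finite.mem_toFinset, Set.mem_ofPred_eq, not_not] at ha⟩

/-- Identities between derivations are checked on components, and only for coordinates on which `φ`
really depends. -/
theorem vf_congr {f g : Crd n E O → JetAlg O W} {φ : JetAlg O W}
    (h : ∀ a, del a φ ≠ 0 → f a = g a) : vf f φ = vf g φ := by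
  refine finsum_congr fun a => ?_
  by_cases ha : del a φ = 0
  · simp only [ha, mul_zero]
  · rw [h a ha]

theorem vf_add (f g : Crd n E O → JetAlg O W) (φ : JetAlg O W) :
    vf (f + g) φ = vf f φ + vf g φ := by
  simp only [vf_apply, Pi.add_apply, add_mul]
  exact finsum_add_distrib (finite_support_mul_del f φ) (finite_support_mul_del g φ)

theorem vf_smul (c : ℝ) (f : Crd n E O → JetAlg O W) (φ : JetAlg O W) :
    vf (c • f) φ = c • vf f φ := by
  simp only [vf_apply, Pi.smul_apply, smul_mul_assoc]
  exact (smul_finsum' c (finite_support_mul_del f φ)).symm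

theorem vf_zero (φ : JetAlg O W) : vf 0 φ = 0 := by
  simp [vf_apply]

open Classical in
-- Presents a partial derivative as a derivation with constant components, so that the bracket
-- formula yields its commutator with a total derivative.
theorem vf_single (a : Crd n E O) (φ : JetAlg O W) : vf (Pi.single a 1) φ = del a φ := by
  rw [vf_apply, finsum_eq_single _ a]
  · simp
  · intro b hb
    simp [hb]

theorem vf_jetVar (f : Crd n E O → JetAlg O W) (A : E ⊕ O) (Λ : MIdx n) :
    vf f (jetVar A Λ) = f (.inr (A, Λ)) := by
  classical
  rw [vf_apply, finsum_eq_single _ (.inr (A, Λ))]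
  · simp [del_jetVar]
  · intro b hb
    simp [del_jetVar, hb]

theorem vf_one (f : Crd n E O → JetAlg O W) : vf f 1 = 0 := by
  simp [vf_apply, del_one]

/-- The components `f` define a derivation of parity `p`. -/
def IsHomogeneous (p : ZMod 2) (f : Crd n E O → JetAlg O W) : Prop :=
  ∀ a, HasParity (p + crdParity a) (f a)

theorem zmod_two_add_self (p : ZMod 2) : p + p = 0 := CharTwo.add_self_eq_zero p

/-- The graded Leibniz rule. -/
theorem vf_mul {p : ZMod 2} {f : Crd n E O → JetAlg O W} (hf : IsHomogeneous p f)
    (φ ψ : JetAlg O W) : vf f (φ * ψ) = vf f φ * ψ + gradeInvPow p φ * vf f ψ := by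
  classical
  obtain ⟨S, hS⟩ := exists_finset_del_eq_zero φ
  obtain ⟨S', hS'⟩ := exists_finset_del_eq_zero ψ
  have h1 : ∀ a ∉ S ∪ S', del a φ = 0 := fun a ha => hS a fun h => ha (Finset.mem_union_left _ h)
  have h2 : ∀ a ∉ S ∪ S', del a ψ = 0 := fun a ha => hS' a fun h => ha (Finset.mem_union_right _ h)
  have h3 : ∀ a ∉ S ∪ S', del a (φ * ψ) = 0 := fun a ha => by
    rw [del_mul, h1 a ha, h2 a ha, zero_mul, mul_zero, add_zero]
  rw [vf_eq_sum f h1, vf_eq_sum f h2, vf_eq_sum f h3, Finset.sum_mul, Finset.mul_sum,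
    ← Finset.sum_add_distrib]
  refine Finset.sum_congr rfl fun a _ => ?_
  -- Moving `f a` past `φ` costs the involution to the power `p + |a|`. The Leibniz rule for `∂_a`
  -- already contributed `|a|`, and the two copies of `|a|` cancel modulo 2.
  rw [del_mul, mul_add, ← mul_assoc, ← mul_assoc, (hf a).mul_eq (gradeInvPow _ φ),
    gradeInvPow_gradeInvPow, add_assoc, zmod_two_add_self, add_zero, mul_assoc _ (f a)]

theorem HasParity.vf {p q : ZMod 2} {f : Crd n E O → JetAlg O W} (hf : IsHomogeneous p f)
    {φ : JetAlg O W} (h : HasParity q φ) : HasParity (p + q) (vf f φ) := by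
  refine hasParity_finsum fun a => ?_
  have := (hf a).mul (h.pderiv a)
  rwa [add_comm q, add_assoc, ← add_assoc (crdParity a), zmod_two_add_self, zero_add] at this

/-- A composition splits into a first-order part, which is again a derivation, and a second-order
part. The latter is kept explicit so that it can be cancelled in the bracket. -/
theorem vf_vf {p q : ZMod 2} {f g : Crd n E O → JetAlg O W} (hf : IsHomogeneous p f)
    (hg : IsHomogeneous q g) {φ : JetAlg O W} {S : Finset (Crd n E O)}
    (hS : ∀ a ∉ S, del a φ = 0) :
    vf f (vf g φ) = vf (fun b => vf f (g b)) φ +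
      ∑ b ∈ S, ∑ a ∈ S, sgn (p * (q + crdParity b)) • (g b * (f a * del a (del b φ))) := by
  rw [vf_eq_sum g hS, vf_eq_sum _ hS, map_sum, ← Finset.sum_add_distrib]
  refine Finset.sum_congr rfl fun b _ => ?_
  have hS' : ∀ a ∉ S, del a (del b φ) = 0 := fun a ha => by
    rw [del_comm, hS a ha, map_zero, smul_zero]
  rw [vf_mul hf, (hg b).gradeInvPow_eq, vf_eq_sum f hS', smul_mul_assoc, Finset.mul_sum,
    Finset.smul_sum]

/-- The graded bracket of two derivations. -/
theorem vf_bracket {p q : ZMod 2} {f g : Crd n E O → JetAlg O W} (hf : IsHomogeneous p f)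
    (hg : IsHomogeneous q g) (φ : JetAlg O W) :
    vf f (vf g φ) - sgn (p * q) • vf g (vf f φ) =
      vf (fun a => vf f (g a) - sgn (p * q) • vf g (f a)) φ := by
  obtain ⟨S, hS⟩ := exists_finset_del_eq_zero φ
  have hlin : vf (fun a => vf f (g a) - sgn (p * q) • vf g (f a)) φ =
      vf (fun a => vf f (g a)) φ - sgn (p * q) • vf (fun a => vf g (f a)) φ := by
    rw [← vf_smul, sub_eq_add_neg, ← neg_one_smul ℝ (vf _ φ), ← vf_smul, ← vf_add]
    congr 2
    funext a
    simp [sub_eq_add_neg]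
  -- The first-order parts already agree with the right-hand side. It remains to match the two
  -- second-order sums term by term, after exchanging the order of summation in one of them.
  rw [hlin, vf_vf hf hg hS, vf_vf hg hf hS, smul_add, add_sub_add_comm, add_eq_left, sub_eq_zero,
    Finset.sum_comm, Finset.smul_sum]
  refine Finset.sum_congr rfl fun a _ => ?_
  rw [Finset.smul_sum]
  refine Finset.sum_congr rfl fun b _ => ?_
  rw [← mul_assoc, ← mul_assoc, (hg b).mul_comm (hf a), del_comm a b, smul_mul_assoc,
    mul_smul_comm, smul_smul, smul_smul, smul_smul]
  -- Components and partial derivatives have been commuted; an identity of signs in four parities is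
  -- left.
  congr 1
  generalize crdParity a = x
  generalize crdParity b = y
  rcases zmod_two_cases p with rfl | rfl <;> rcases zmod_two_cases q with rfl | rfl <;>
    rcases zmod_two_cases x with rfl | rfl <;> rcases zmod_two_cases y with rfl | rfl <;>
    simp [show (1 + 1 : ZMod 2) = 0 from rfl]

/-! ### Total derivatives -/

theorem vf_inl_inr (f : Crd n E O → JetAlg O W) (φ : JetAlg O W) :
    vf f φ = ∑ i, f (.inl i) * pdx i φ + ∑ᶠ a : (E ⊕ O) × MIdx n, f (.inr a) * pd a.1 a.2 φ := by
  classical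
  obtain ⟨S, hS⟩ := exists_finset_del_eq_zero φ
  have h1 : ∀ a ∉ (Finset.univ : Finset (Fin n)).disjSum S.toRight, del a φ = 0 := by
    intro a ha
    refine hS a fun h => ha ?_
    rcases a with i | a
    · simp
    · simpa using h
  rw [vf_eq_sum f h1, Finset.sum_disjSum]
  congr 1
  refine (finsum_eq_sum_of_support_subset _ fun a ha => ?_).symm
  by_contra h
  refine ha ?_
  have : pd a.1 a.2 φ = 0 := hS (.inr a) (by simpa using h)
  change f (.inr a) * pd a.1 a.2 φ = 0
  rw [this, mul_zero]

open Classical in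
/-- The components of the total derivative. -/
def totalComp (i : Fin n) : Crd n E O → JetAlg O W
  | .inl j => if j = i then 1 else 0
  | .inr a => jetVar a.1 (a.2 + Finsupp.single i 1)

theorem totalD_eq_vf (i : Fin n) (φ : JetAlg O W) : totalD i φ = vf (totalComp i) φ := by
  rw [vf_inl_inr]
  simp [totalD, totalComp]

theorem isHomogeneous_totalComp (i : Fin n) :
    IsHomogeneous 0 (totalComp i : Crd n E O → JetAlg O W) := by
  rintro (j | a)
  · simp only [totalComp, crdParity, add_zero]
    split_ifs
    · exact hasParity_one
    · exact hasParity_zero _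
  · rw [zero_add]
    exact hasParity_jetVar _ _

/-- The total derivative as a linear map. -/
def totalDL (i : Fin n) : Module.End ℝ (JetAlg O W) := vf (totalComp i)

theorem totalD_eq (i : Fin n) (φ : JetAlg O W) : totalD i φ = totalDL i φ :=
  totalD_eq_vf i φ

theorem totalDL_mul (i : Fin n) (φ ψ : JetAlg O W) :
    totalDL i (φ * ψ) = totalDL i φ * ψ + φ * totalDL i ψ := by
  refine (vf_mul (isHomogeneous_totalComp i) φ ψ).trans ?_
  rw [gradeInvPow_zero]
  rfl

theorem totalDL_jetVar (i : Fin n) (A : E ⊕ O) (Λ : MIdx n) :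
    totalDL i (jetVar A Λ : JetAlg O W) = jetVar A (Λ + Finsupp.single i 1) :=
  vf_jetVar _ _ _

theorem HasParity.totalDL {p : ZMod 2} {φ : JetAlg O W} (h : HasParity p φ) (i : Fin n) :
    HasParity p (totalDL i φ) := by
  have := HasParity.vf (isHomogeneous_totalComp i) h
  rwa [zero_add] at this

/-- The bracket of two total derivatives has zero components: base components are constants, and
both orders send `s^A_Λ` to the same jet variable. -/
theorem totalDL_comm (i j : Fin n) (φ : JetAlg O W) :
    totalDL i (totalDL j φ) = totalDL j (totalDL i φ) := by
  have := vf_bracket (isHomogeneous_totalComp i) (isHomogeneous_totalComp j) φ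
  rw [mul_zero, sgn_zero, one_smul] at this
  rw [← sub_eq_zero]
  refine this.trans ((vf_congr (g := 0) fun a _ => ?_).trans (vf_zero φ))
  rcases a with k | a
  · simp only [totalComp, one_smul, Pi.zero_apply]
    split_ifs <;> simp [vf_one]
  · simp only [totalComp, vf_jetVar, one_smul, Pi.zero_apply]
    rw [add_right_comm, sub_self]

/-- `d_Λ` as a linear map. -/
def totalDsL (Λ : MIdx n) : Module.End ℝ (JetAlg O W) :=
  ((List.finRange n).map fun i => totalDL i ^ Λ i).prod

theorem totalDs_eq (Λ : MIdx n) (φ : JetAlg O W) : totalDs Λ φ = totalDsL Λ φ := by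
  unfold totalDs totalDsL
  induction List.finRange n with
  | nil => rfl
  | cons i l ih =>
    rw [List.foldr_cons, ih, List.map_cons, List.prod_cons, Module.End.mul_apply,
      Module.End.pow_apply, show totalD i = ⇑(totalDL (O := O) (W := W) i) from
        funext (totalD_eq i)]

theorem commute_totalDL (i j : Fin n) :
    Commute (totalDL i : Module.End ℝ (JetAlg O W)) (totalDL j) :=
  LinearMap.ext fun φ => totalDL_comm i j φ

theorem totalDsL_add (Λ Ξ : MIdx n) :
    (totalDsL (Λ + Ξ) : Module.End ℝ (JetAlg O W)) = totalDsL Λ * totalDsL Ξ := by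
  unfold totalDsL
  induction List.finRange n with
  | nil => simp
  | cons i l ih =>
    have hc : Commute ((totalDL i : Module.End ℝ (JetAlg O W)) ^ Ξ i)
        (l.map fun j => (totalDL j : Module.End ℝ (JetAlg O W)) ^ Λ j).prod := by
      refine Commute.list_prod_right _ _ fun x hx => ?_
      obtain ⟨j, -, rfl⟩ := List.mem_map.1 hx
      exact (commute_totalDL i j).pow_pow _ _
    rw [List.map_cons, List.prod_cons, ih, List.map_cons, List.prod_cons, List.map_cons,
      List.prod_cons, Finsupp.add_apply, pow_add, mul_assoc, mul_assoc]
    congr 1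
    rw [← mul_assoc, hc.eq, mul_assoc]

theorem totalDsL_zero : (totalDsL 0 : Module.End ℝ (JetAlg O W)) = 1 := by
  unfold totalDsL
  exact List.prod_eq_one (by simp)

theorem totalDsL_single (i : Fin n) :
    (totalDsL (Finsupp.single i 1) : Module.End ℝ (JetAlg O W)) = totalDL i := by
  classical
  unfold totalDsL
  rw [List.prod_map_eq_pow_single i]
  · simp [List.count_eq_one_of_mem (List.nodup_finRange n) (List.mem_finRange i)]
  · intro j hj _
    simp [Finsupp.single_eq_of_ne hj]

theorem totalDsL_add_single (Λ : MIdx n) (i : Fin n) (φ : JetAlg O W) :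
    totalDsL (Λ + Finsupp.single i 1) φ = totalDL i (totalDsL Λ φ) := by
  rw [add_comm, totalDsL_add, totalDsL_single, Module.End.mul_apply]

theorem totalDL_totalDsL_comm (Λ : MIdx n) (i : Fin n) (φ : JetAlg O W) :
    totalDsL Λ (totalDL i φ) = totalDL i (totalDsL Λ φ) := by
  rw [← totalDsL_add_single, totalDsL_add, totalDsL_single, Module.End.mul_apply]

/-- Induction on multi-indices. -/
theorem midx_induction {P : MIdx n → Prop} (Λ : MIdx n) (h0 : P 0)
    (h1 : ∀ Λ i, P Λ → P (Λ + Finsupp.single i 1)) : P Λ := by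
  induction Λ using Finsupp.induction with
  | zero => exact h0
  | single_add i k f _ _ hf =>
    clear * - h1 hf
    rw [add_comm]
    induction k with
    | zero => simpa using hf
    | succ k ih => rw [Finsupp.single_add, ← add_assoc]; exact h1 _ i ih

theorem totalDsL_jetVar (Λ Ξ : MIdx n) (A : E ⊕ O) :
    totalDsL Λ (jetVar A Ξ : JetAlg O W) = jetVar A (Ξ + Λ) := by
  induction Λ using midx_induction with
  | h0 => simp [totalDsL_zero]
  | h1 Λ i h => rw [totalDsL_add_single, h, totalDL_jetVar, add_assoc]

theorem HasParity.totalDsL {p : ZMod 2} {φ : JetAlg O W} (h : HasParity p φ) (Λ : MIdx n) :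
    HasParity p (totalDsL Λ φ) := by
  induction Λ using midx_induction with
  | h0 => simpa [totalDsL_zero] using h
  | h1 Λ i h => rw [totalDsL_add_single]; exact h.totalDL i

/-! ### Prolongations -/

/-- The components of the prolongation of a vertical derivation. -/
def prolongComp (υ : (E ⊕ O) → JetAlg O W) : Crd n E O → JetAlg O W
  | .inl _ => 0
  | .inr a => totalDsL a.2 (υ a.1)

theorem prolong_eq (υ : (E ⊕ O) → JetAlg O W) : prolong υ = vf (prolongComp υ) := by
  funext φ
  rw [vf_inl_inr]
  simp only [prolong, prolongComp, zero_mul, Finset.sum_const_zero, zero_add]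
  simp only [totalDs_eq]

theorem isHomogeneous_prolongComp {p : ZMod 2} {υ : (E ⊕ O) → JetAlg O W}
    (h : ∀ A, HasParity (p + parity A) (υ A)) : IsHomogeneous p (prolongComp υ) := by
  rintro (j | a)
  · exact hasParity_zero _
  · exact (h a.1).totalDsL _

theorem prolong_jetVar (υ : (E ⊕ O) → JetAlg O W) (A : E ⊕ O) :
    prolong υ (jetVar A 0) = υ A := by
  simp [prolong_eq, vf_jetVar, prolongComp, totalDsL_zero]

/-- The bracket with `d_i` has zero components, because the component of a prolongation at `Λ + i`
is `d_i` of its component at `Λ`. -/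
theorem vf_prolongComp_totalDL {p : ZMod 2} {υ : (E ⊕ O) → JetAlg O W}
    (h : ∀ A, HasParity (p + parity A) (υ A)) (i : Fin n) (φ : JetAlg O W) :
    vf (prolongComp υ) (totalDL i φ) = totalDL i (vf (prolongComp υ) φ) := by
  have := vf_bracket (isHomogeneous_prolongComp h) (isHomogeneous_totalComp i) φ
  rw [mul_zero, sgn_zero, one_smul] at this
  rw [← sub_eq_zero]
  refine this.trans ((vf_congr (g := 0) fun a _ => ?_).trans (vf_zero φ))
  rcases a with k | a
  · simp only [totalComp, one_smul, Pi.zero_apply, prolongComp, map_zero]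
    split_ifs <;> simp [vf_one]
  · simp only [totalComp, vf_jetVar, one_smul, Pi.zero_apply, prolongComp]
    rw [totalDsL_add_single, sub_eq_zero]
    rfl

theorem vf_prolongComp_totalDsL {p : ZMod 2} {υ : (E ⊕ O) → JetAlg O W}
    (h : ∀ A, HasParity (p + parity A) (υ A)) (Λ : MIdx n) (φ : JetAlg O W) :
    vf (prolongComp υ) (totalDsL Λ φ) = totalDsL Λ (vf (prolongComp υ) φ) := by
  induction Λ using midx_induction with
  | h0 => simp [totalDsL_zero]
  | h1 Λ i ih => rw [totalDsL_add_single, vf_prolongComp_totalDL h, ih, totalDsL_add_single]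

/-- Since prolongations commute with every `d_Λ`, their bracket is fixed by its values on the
variables of jet order zero. -/
theorem prolong_bracket {p q : ZMod 2} {υ ν : (E ⊕ O) → JetAlg O W}
    (h : ∀ A, HasParity (p + parity A) (υ A)) (h' : ∀ A, HasParity (q + parity A) (ν A))
    (φ : JetAlg O W) :
    prolong υ (prolong ν φ) - sgn (p * q) • prolong ν (prolong υ φ) =
      prolong (fun A => prolong υ (ν A) - sgn (p * q) • prolong ν (υ A)) φ := by
  simp only [prolong_eq]
  rw [vf_bracket (isHomogeneous_prolongComp h) (isHomogeneous_prolongComp h')]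
  refine vf_congr fun a _ => ?_
  rcases a with k | a
  · simp [prolongComp]
  · simp only [prolongComp, map_sub, map_smul]
    rw [vf_prolongComp_totalDsL h, vf_prolongComp_totalDsL h']

theorem prolong_add (υ ν : (E ⊕ O) → JetAlg O W) (φ : JetAlg O W) :
    prolong (υ + ν) φ = prolong υ φ + prolong ν φ := by
  simp only [prolong_eq, ← vf_add]
  refine vf_congr fun a _ => ?_
  rcases a with k | a <;> simp [prolongComp]

open Classical in
/-- The commutator of a partial and a total derivative. -/
theorem pd_totalDL (A : E ⊕ O) (Λ : MIdx n) (i : Fin n) (φ : JetAlg O W) :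
    pd A Λ (totalDL i φ) = totalDL i (pd A Λ φ) +
      if 1 ≤ Λ i then pd A (Λ - Finsupp.single i 1) φ else 0 := by
  have hs : IsHomogeneous (parity A)
      (Pi.single (.inr (A, Λ)) 1 : Crd n E O → JetAlg O W) := by
    intro b
    by_cases hb : b = .inr (A, Λ)
    · subst hb
      rw [Pi.single_eq_same, show crdParity (.inr (A, Λ)) = parity A from rfl, zmod_two_add_self]
      exact hasParity_one
    · rw [Pi.single_eq_of_ne hb]
      exact hasParity_zero _
  have := vf_bracket hs (isHomogeneous_totalComp i) φ
  rw [mul_zero, sgn_zero, one_smul, sub_eq_iff_eq_add', vf_single] at this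
  refine this.trans ?_
  rw [vf_single]
  refine congrArg₂ (· + ·) rfl ?_
  have hz : ∀ b, vf (totalComp i) ((Pi.single (.inr (A, Λ)) 1 : Crd n E O → JetAlg O W) b) = 0 := by
    intro b
    by_cases hb : b = .inr (A, Λ)
    · subst hb
      rw [Pi.single_eq_same, vf_one]
    · rw [Pi.single_eq_of_ne hb, map_zero]
  simp only [hz, vf_single, smul_zero, sub_zero]
  -- The bracket has the single component 1 at `(A, Λ - i)`. If `Λ i = 0`, truncated subtraction
  -- would return `Λ` itself; then `s^A_Λ` is not of the form `s^B_{Ξ+i}` and the bracket vanishes.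
  split_ifs with hi
  · change _ = del (.inr (A, Λ - Finsupp.single i 1)) φ
    rw [← vf_single]
    refine vf_congr fun b _ => ?_
    rcases b with j | ⟨B, Ξ⟩
    · simp only [totalComp]
      split_ifs <;> simp [del_one]
    · have hle : Finsupp.single i 1 ≤ Λ := by simpa using hi
      have hiff : (Sum.inr (A, Λ) : Crd n E O) = .inr (B, Ξ + Finsupp.single i 1) ↔
          (Sum.inr (B, Ξ) : Crd n E O) = .inr (A, Λ - Finsupp.single i 1) := by
        simp only [Sum.inr.injEq, Prod.mk.injEq]
        constructor
        · rintro ⟨rfl, rfl⟩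
          simp
        · rintro ⟨rfl, rfl⟩
          exact ⟨rfl, (tsub_add_cancel_of_le hle).symm⟩
      simp only [totalComp, del_jetVar, hiff, Pi.single_apply]
  · refine (vf_congr (g := 0) fun b _ => ?_).trans (vf_zero φ)
    rcases b with j | ⟨B, Ξ⟩
    · simp only [totalComp]
      split_ifs <;> simp [del_one]
    · have hne : (Sum.inr (A, Λ) : Crd n E O) ≠ .inr (B, Ξ + Finsupp.single i 1) := by
        intro h
        simp only [Sum.inr.injEq, Prod.mk.injEq] at h
        refine hi ?_
        rw [h.2]
        simp
      simp [totalComp, del_jetVar, hne]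

end GradedDerivations


/-! ### The variational calculus: divergences, Euler–Lagrange operators, formal adjoints. -/

section Variational

variable {n : ℕ} {E O : Type} {W : TopologicalSpace.Opens ((Fin n → ℝ) × (E → ℝ))}

/-! ### Total divergences -/

/-- The space of total divergences. -/
def divergences : Submodule ℝ (JetAlg O W) := ⨆ i, LinearMap.range (totalDL i)

theorem totalDL_mem_divergences (i : Fin n) (φ : JetAlg O W) : totalDL i φ ∈ divergences :=
  Submodule.mem_iSup_of_mem i ⟨φ, rfl⟩

/-- Integration by parts. -/
theorem totalDsL_mul_sub_mem_divergences (Λ : MIdx n) (φ ψ : JetAlg O W) :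
    totalDsL Λ φ * ψ - (-1 : ℝ) ^ Λ.degree • (φ * totalDsL Λ ψ) ∈ divergences := by
  induction Λ using midx_induction generalizing ψ with
  | h0 => simp [totalDsL_zero]
  | h1 Λ i ih =>
    -- One derivative is moved by subtracting from the divergence `d_i(d_Λ φ · ψ)` the inductive
    -- hypothesis for `d_i ψ`.
    have h := Submodule.sub_mem _ (totalDL_mem_divergences i (totalDsL Λ φ * ψ))
      (ih (totalDL i ψ))
    rw [totalDL_mul, totalDL_totalDsL_comm] at h
    rw [map_add, Finsupp.degree_single, pow_succ, mul_neg_one, neg_smul, totalDsL_add_single,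
      totalDsL_add_single]
    convert h using 1
    abel

theorem finite_pd_ne_zero (A : E ⊕ O) (φ : JetAlg O W) : {Λ : MIdx n | pd A Λ φ ≠ 0}.Finite :=
  (finite_del_ne_zero φ).preimage (f := fun Λ => (Sum.inr (A, Λ) : Crd n E O))
    fun _ _ _ _ h => by simpa using h

theorem varD_eq (A : E ⊕ O) (φ : JetAlg O W) :
    varD A φ = ∑ᶠ Λ : MIdx n, ((-1 : ℝ) ^ Λ.degree) • totalDsL Λ (pd A Λ φ) := by
  simp only [varD, totalDs_eq]

theorem finite_support_varD (A : E ⊕ O) (φ : JetAlg O W) :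
    (Function.support fun Λ : MIdx n => ((-1 : ℝ) ^ Λ.degree) • totalDsL Λ (pd A Λ φ)).Finite :=
  (finite_pd_ne_zero A φ).subset fun Λ hΛ h => hΛ (by simp only [h, map_zero, smul_zero])

theorem varD_add (A : E ⊕ O) (φ ψ : JetAlg O W) : varD A (φ + ψ) = varD A φ + varD A ψ := by
  simp only [varD_eq, map_add, smul_add]
  exact finsum_add_distrib (finite_support_varD A φ) (finite_support_varD A ψ)

theorem varD_zero (A : E ⊕ O) : varD A (0 : JetAlg O W) = 0 := by
  simp [varD_eq]

/-- Variational derivatives vanish on total derivatives. -/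
theorem varD_totalDL (A : E ⊕ O) (i : Fin n) (φ : JetAlg O W) : varD A (totalDL i φ) = 0 := by
  classical
  -- `F` is the term in which `∂_A^Λ` has passed `d_i`. The commutator contributes the same family
  -- shifted by one index in direction `i`, with opposite sign: this is `-G`. The sums of `F` and
  -- `G` therefore cancel.
  let F : MIdx n → JetAlg O W := fun Λ =>
    ((-1 : ℝ) ^ Λ.degree) • totalDL i (totalDsL Λ (pd A Λ φ))
  let G : MIdx n → JetAlg O W := fun Λ =>
    if 1 ≤ Λ i then F (Λ - Finsupp.single i 1) else 0
  have hS := finite_pd_ne_zero A φ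
  have hF0 : ∀ Λ, Λ ∉ hS.toFinset → F Λ = 0 := fun Λ h => by
    rw [Set.Finite.mem_toFinset, Set.mem_ofPred_eq, not_not] at h
    simp only [F, h, map_zero, smul_zero]
  let e : MIdx n ↪ MIdx n := ⟨fun Λ => Λ + Finsupp.single i 1, add_left_injective _⟩
  have hterm : ∀ Λ : MIdx n, ((-1 : ℝ) ^ Λ.degree) • totalDsL Λ (pd A Λ (totalDL i φ)) =
      F Λ - G Λ := by
    intro Λ
    rw [pd_totalDL, map_add, totalDL_totalDsL_comm, smul_add, sub_eq_add_neg]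
    congr 1
    simp only [G]
    split_ifs with h
    · obtain ⟨Ξ, rfl⟩ : ∃ Ξ, Λ = Ξ + Finsupp.single i 1 :=
        ⟨Λ - Finsupp.single i 1, (tsub_add_cancel_of_le (by simpa using h)).symm⟩
      rw [add_tsub_cancel_right, totalDsL_add_single, map_add, Finsupp.degree_single, pow_succ,
        mul_neg_one, neg_smul]
    · simp
  have hG0 : ∀ Λ, Λ ∉ hS.toFinset.map e → G Λ = 0 := by
    intro Λ h
    simp only [G]
    split_ifs with h1
    · refine hF0 _ fun h2 => h ?_
      rw [Finset.mem_map]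
      exact ⟨_, h2, tsub_add_cancel_of_le (by simpa using h1)⟩
    · rfl
  have hFs : Function.support F ⊆ hS.toFinset := fun Λ h => by
    by_contra h'
    exact h (hF0 Λ h')
  have hGs : Function.support G ⊆ hS.toFinset.map e := fun Λ h => by
    by_contra h'
    exact h (hG0 Λ h')
  rw [varD_eq]
  simp only [hterm]
  rw [finsum_sub_distrib ((Finset.finite_toSet _).subset hFs) ((Finset.finite_toSet _).subset hGs),
    finsum_eq_sum_of_support_subset _ hFs, finsum_eq_sum_of_support_subset _ hGs, Finset.sum_map,
    sub_eq_zero]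
  refine Finset.sum_congr rfl fun Λ _ => ?_
  simp [G, e]

theorem isVariationallyTrivial_of_mem_divergences {φ : JetAlg O W} (h : φ ∈ divergences) :
    IsVariationallyTrivial φ := by
  intro A
  induction h using Submodule.iSup_induction' with
  | mem i x hx =>
    obtain ⟨ψ, rfl⟩ := hx
    exact varD_totalDL A i ψ
  | zero => exact varD_zero A
  | add x y _ _ hx hy => rw [varD_add, hx, hy, add_zero]

/-- The first variational formula. -/
theorem prolong_sub_sum_mem_divergences [Fintype E] [Fintype O] (υ : (E ⊕ O) → JetAlg O W)
    (φ : JetAlg O W) : prolong υ φ - ∑ A, υ A * varD A φ ∈ divergences := by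
  classical
  let S : Finset (MIdx n) := Finset.univ.biUnion fun A : E ⊕ O => (finite_pd_ne_zero A φ).toFinset
  have hS : ∀ (A : E ⊕ O) (Λ : MIdx n), Λ ∉ S → pd A Λ φ = 0 := by
    intro A Λ h
    by_contra h'
    refine h (Finset.mem_biUnion.2 ⟨A, Finset.mem_univ _, ?_⟩)
    rwa [Set.Finite.mem_toFinset]
  have h1 : prolong υ φ = ∑ A, ∑ Λ ∈ S, totalDsL Λ (υ A) * pd A Λ φ := by
    rw [← Finset.sum_product']
    simp only [prolong, totalDs_eq]
    refine finsum_eq_sum_of_support_subset _ fun a ha => ?_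
    by_contra h
    refine ha ?_
    change _ * _ = _
    rw [hS a.1 a.2 (fun h' => h (by simpa using h')), mul_zero]
  have h2 : ∀ A, varD A φ = ∑ Λ ∈ S, ((-1 : ℝ) ^ Λ.degree) • totalDsL Λ (pd A Λ φ) := by
    intro A
    rw [varD_eq]
    refine finsum_eq_sum_of_support_subset _ fun Λ hΛ => ?_
    by_contra h
    refine hΛ ?_
    change _ • _ = _
    rw [hS A Λ h, map_zero, smul_zero]
  rw [h1, ← Finset.sum_sub_distrib]
  refine Submodule.sum_mem _ fun A _ => ?_
  rw [h2, Finset.mul_sum, ← Finset.sum_sub_distrib]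
  refine Submodule.sum_mem _ fun Λ _ => ?_
  rw [mul_smul_comm]
  exact totalDsL_mul_sub_mem_divergences Λ _ _

/-! ### Formal adjoints -/

/-- The product of binomial coefficients of two multi-indices. -/
def midxChoose (Ξ Λ : MIdx n) : ℝ := ∏ i, ((Ξ i).choose (Λ i) : ℝ)

theorem midxChoose_eq_zero {Ξ Λ : MIdx n} (h : ¬ Λ ≤ Ξ) : midxChoose Ξ Λ = 0 := by
  rw [Finsupp.le_def, not_forall] at h
  obtain ⟨i, hi⟩ := h
  refine Finset.prod_eq_zero (Finset.mem_univ i) ?_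
  rw [Nat.choose_eq_zero_of_lt (not_le.1 hi), Nat.cast_zero]

/-- Pascal's rule in the factor of index `i`, the other factors being unchanged. -/
theorem midxChoose_add_single (Ξ Λ : MIdx n) (i : Fin n) :
    midxChoose (Ξ + Finsupp.single i 1) Λ = midxChoose Ξ Λ +
      if 1 ≤ Λ i then midxChoose Ξ (Λ - Finsupp.single i 1) else 0 := by
  classical
  have hne : ∀ j ∈ Finset.univ.erase i, j ≠ i := fun j hj => Finset.ne_of_mem_erase hj
  unfold midxChoose
  simp only [← Finset.mul_prod_erase Finset.univ _ (Finset.mem_univ i)]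
  have h1 : ∏ j ∈ Finset.univ.erase i, (((Ξ + Finsupp.single i 1 : MIdx n) j).choose (Λ j) : ℝ) =
      ∏ j ∈ Finset.univ.erase i, ((Ξ j).choose (Λ j) : ℝ) :=
    Finset.prod_congr rfl fun j hj => by simp [Finsupp.single_eq_of_ne (hne j hj)]
  have h2 : ∏ j ∈ Finset.univ.erase i, ((Ξ j).choose ((Λ - Finsupp.single i 1 : MIdx n) j) : ℝ) =
      ∏ j ∈ Finset.univ.erase i, ((Ξ j).choose (Λ j) : ℝ) :=
    Finset.prod_congr rfl fun j hj => by simp [Finsupp.single_eq_of_ne (hne j hj)]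
  rw [h1, h2]
  split_ifs with h
  · obtain ⟨k, hk⟩ : ∃ k, Λ i = k + 1 := ⟨Λ i - 1, by omega⟩
    simp only [Finsupp.add_apply, Finsupp.tsub_apply, Finsupp.single_eq_same, hk,
      Nat.choose_succ_succ, Nat.succ_eq_add_one, Nat.add_sub_cancel]
    push_cast
    ring
  · have hk : Λ i = 0 := by omega
    simp [hk]

/-- The Leibniz rule for multiple total derivatives. -/
theorem totalDsL_mul (Ξ : MIdx n) (φ ψ : JetAlg O W) :
    totalDsL Ξ (φ * ψ) =
      ∑ Λ ∈ Finset.Icc 0 Ξ, midxChoose Ξ Λ • (totalDsL Λ φ * totalDsL (Ξ - Λ) ψ) := by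
  classical
  induction Ξ using midx_induction with
  | h0 => simp [totalDsL_zero, midxChoose]
  | h1 Ξ i ih =>
    rw [totalDsL_add_single, ih, map_sum]
    simp only [map_smul, totalDL_mul, smul_add, ← totalDsL_add_single]
    -- Terms with the new derivative on `ψ` keep `Λ`, and those with it on `φ` shift `Λ` by one.
    -- They match the two summands of Pascal's rule.
    rw [Finset.sum_add_distrib, add_comm]
    simp only [midxChoose_add_single, add_smul, Finset.sum_add_distrib]
    congr 1
    · have hsub : Finset.Icc 0 Ξ ⊆ Finset.Icc 0 (Ξ + Finsupp.single i 1) :=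
        Finset.Icc_subset_Icc_right le_self_add
      rw [← Finset.sum_subset hsub]
      · refine Finset.sum_congr rfl fun Λ hΛ => ?_
        rw [tsub_add_eq_add_tsub (Finset.mem_Icc.1 hΛ).2]
      · intro Λ _ hΛ
        rw [midxChoose_eq_zero fun h => hΛ (Finset.mem_Icc.2 ⟨zero_le, h⟩), zero_smul]
    · simp only [ite_smul, zero_smul]
      rw [← Finset.sum_filter]
      refine Finset.sum_bij (fun Λ _ => Λ + Finsupp.single i 1) ?_ ?_ ?_ ?_
      · intro Λ hΛ
        simp only [Finset.mem_filter, Finset.mem_Icc, zero_le, true_and] at hΛ ⊢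
        exact ⟨add_le_add_left hΛ _, by simp⟩
      · intro Λ _ Λ' _ h
        exact add_left_injective _ h
      · intro Λ hΛ
        simp only [Finset.mem_filter, Finset.mem_Icc, zero_le, true_and] at hΛ
        exact ⟨Λ - Finsupp.single i 1,
          Finset.mem_Icc.2 ⟨zero_le, tsub_le_iff_right.2 hΛ.1⟩,
          tsub_add_cancel_of_le (by simpa using hΛ.2)⟩
      · intro Λ _
        rw [add_tsub_cancel_right, add_tsub_add_eq_tsub_right]

/-- The case distinction is superfluous, as the binomial product vanishes unless `Λ ≤ Ξ`. -/
theorem adj_eq (f : MIdx n →₀ JetAlg O W) (Λ : MIdx n) :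
    adj f Λ = f.sum fun Ξ a =>
      ((-1 : ℝ) ^ Ξ.degree * midxChoose Ξ Λ) • totalDsL (Ξ - Λ) a := by
  unfold adj
  refine Finset.sum_congr rfl fun Ξ _ => ?_
  dsimp only
  split_ifs with h
  · rw [totalDs_eq]
    rfl
  · rw [midxChoose_eq_zero h, mul_zero, zero_smul]

theorem finite_adj_ne_zero (f : MIdx n →₀ JetAlg O W) : {Λ | adj f Λ ≠ 0}.Finite := by
  classical
  refine (f.support.biUnion fun Ξ => Finset.Icc 0 Ξ).finite_toSet.subset fun Λ hΛ => ?_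
  by_contra h
  refine hΛ ?_
  rw [adj_eq]
  refine Finset.sum_eq_zero fun Ξ hΞ => ?_
  dsimp only
  rw [midxChoose_eq_zero, mul_zero, zero_smul]
  intro hle
  exact h (Finset.mem_coe.2 (Finset.mem_biUnion.2 ⟨Ξ, hΞ, Finset.mem_Icc.2 ⟨zero_le, hle⟩⟩))

/-- The defining property of the formal adjoint. -/
theorem finsum_totalDsL_mul_adj (f : MIdx n →₀ JetAlg O W) (φ : JetAlg O W) :
    ∑ᶠ Λ : MIdx n, totalDsL Λ φ * adj f Λ =
      f.sum fun Ξ a => (-1 : ℝ) ^ Ξ.degree • totalDsL Ξ (φ * a) := by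
  classical
  let S : Finset (MIdx n) := f.support.biUnion fun Ξ => Finset.Icc 0 Ξ
  have hS : ∀ Ξ ∈ f.support, Finset.Icc 0 Ξ ⊆ S := fun Ξ h =>
    Finset.subset_biUnion_of_mem (fun Ξ => Finset.Icc 0 Ξ) h
  have h1 : ∑ᶠ Λ : MIdx n, totalDsL Λ φ * adj f Λ = ∑ Λ ∈ S, totalDsL Λ φ * adj f Λ := by
    refine finsum_eq_sum_of_support_subset _ fun Λ hΛ => ?_
    by_contra h
    refine hΛ ?_
    change _ * _ = _
    rw [adj_eq, Finsupp.sum, Finset.sum_eq_zero, mul_zero]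
    intro Ξ hΞ
    rw [midxChoose_eq_zero, mul_zero, zero_smul]
    exact fun hle => h (hS Ξ hΞ (Finset.mem_Icc.2 ⟨zero_le, hle⟩))
  rw [h1]
  simp only [adj_eq, Finsupp.sum, Finset.mul_sum]
  rw [Finset.sum_comm]
  refine Finset.sum_congr rfl fun Ξ hΞ => ?_
  rw [totalDsL_mul, Finset.smul_sum]
  rw [← Finset.sum_subset (hS Ξ hΞ)]
  · refine Finset.sum_congr rfl fun Λ _ => ?_
    rw [mul_smul_comm, mul_smul]
  · intro Λ _ hΛ
    rw [midxChoose_eq_zero fun h => hΛ (Finset.mem_Icc.2 ⟨zero_le, h⟩), mul_zero, zero_smul,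
      mul_zero]

theorem hasParity_adj {p : ZMod 2} {f : MIdx n →₀ JetAlg O W} (h : ∀ Λ, HasParity p (f Λ))
    (Λ : MIdx n) : HasParity p (adj f Λ) := by
  rw [adj_eq]
  exact hasParity_sum fun Ξ _ => ((h Ξ).totalDsL _).smul _

end Variational


/-! ### Prolonged derivations acting on fields and on ghosts. -/

section Prolongation

variable {n : ℕ} {E O : Type} {W : TopologicalSpace.Opens ((Fin n → ℝ) × (E → ℝ))}

theorem prolong_mul {p : ZMod 2} {υ : (E ⊕ O) → JetAlg O W}
    (h : ∀ A, HasParity (p + parity A) (υ A)) (φ ψ : JetAlg O W) :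
    prolong υ (φ * ψ) = prolong υ φ * ψ + gradeInvPow p φ * prolong υ ψ := by
  rw [prolong_eq]
  exact vf_mul (isHomogeneous_prolongComp h) φ ψ

theorem prolong_totalDsL {p : ZMod 2} {υ : (E ⊕ O) → JetAlg O W}
    (h : ∀ A, HasParity (p + parity A) (υ A)) (Λ : MIdx n) (φ : JetAlg O W) :
    prolong υ (totalDsL Λ φ) = totalDsL Λ (prolong υ φ) := by
  rw [prolong_eq]
  exact vf_prolongComp_totalDsL h Λ φ

theorem prolong_sum {ι : Type*} (υ : (E ⊕ O) → JetAlg O W) (s : Finset ι) (φ : ι → JetAlg O W) :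
    prolong υ (∑ i ∈ s, φ i) = ∑ i ∈ s, prolong υ (φ i) := by
  rw [prolong_eq, map_sum]

theorem prolong_apply_zero (υ : (E ⊕ O) → JetAlg O W) : prolong υ 0 = 0 := by
  rw [prolong_eq, map_zero]

theorem prolong_apply_add (υ : (E ⊕ O) → JetAlg O W) (φ ψ : JetAlg O W) :
    prolong υ (φ + ψ) = prolong υ φ + prolong υ ψ := by
  rw [prolong_eq, map_add]

theorem prolong_apply_smul (υ : (E ⊕ O) → JetAlg O W) (c : ℝ) (φ : JetAlg O W) :
    prolong υ (c • φ) = c • prolong υ φ := by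
  rw [prolong_eq, map_smul]

theorem prolong_apply_one (υ : (E ⊕ O) → JetAlg O W) : prolong υ 1 = 0 := by
  rw [prolong_eq, vf_one]

end Prolongation

open FieldContent

variable {D : FieldContent} {U : TopologicalSpace.Opens ((Fin D.n → ℝ) × (Fin D.m → ℝ))}

/-! ### Fields and ghosts -/

theorem var_cases {P : D.Var → Prop} (hf : ∀ A, P (D.fld A))
    (hg : ∀ (s : Fin (D.N + 1)) (r : D.Gh s), P (D.gh r)) (v : D.Var) : P v := by
  rcases v with (i | ⟨s, r⟩) | (a | ⟨s, r⟩)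
  · exact hf (.inl i)
  · exact hg s (.inl r)
  · exact hf (.inr a)
  · exact hg s (.inr r)

@[simp] theorem onFields_fld (f : D.Fld → D.Alg U) (A : D.Fld) : onFields f (D.fld A) = f A := by
  rcases A with i | a <;> rfl

@[simp] theorem onFields_gh (f : D.Fld → D.Alg U) {s : Fin (D.N + 1)} (r : D.Gh s) :
    onFields f (D.gh r) = 0 := by
  rcases r with r | r <;> rfl

@[simp] theorem onGhosts_fld (f : ∀ s : Fin (D.N + 1), D.Gh s → D.Alg U) (A : D.Fld) :
    onGhosts f (D.fld A) = 0 := by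
  rcases A with i | a <;> rfl

@[simp] theorem onGhosts_gh (f : ∀ s : Fin (D.N + 1), D.Gh s → D.Alg U) {s : Fin (D.N + 1)}
    (r : D.Gh s) : onGhosts f (D.gh r) = f s r := by
  rcases r with r | r <;> rfl

theorem hasParity_onFields {p : ZMod 2} {f : D.Fld → D.Alg U}
    (h : ∀ A, HasParity (p + parity (D.fld A)) (f A)) (v : D.Var) :
    HasParity (p + parity v) (onFields f v) := by
  induction v using var_cases with
  | hf A => simpa using h A
  | hg s r => simpa using hasParity_zero _

theorem hasParity_onGhosts {p : ZMod 2} {f : ∀ s : Fin (D.N + 1), D.Gh s → D.Alg U}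
    (h : ∀ s r, HasParity (p + parity (D.gh r)) (f s r)) (v : D.Var) :
    HasParity (p + parity v) (onGhosts f v) := by
  induction v using var_cases with
  | hf A => simpa using hasParity_zero _
  | hg s r => simpa using h s r

theorem mem_fieldFns {φ : D.Alg U} :
    φ ∈ D.fieldFns U ↔ ∀ (s : Fin (D.N + 1)) (r : D.Gh s) (Λ : MIdx D.n), pd (D.gh r) Λ φ = 0 := by
  simp only [fieldFns, Submodule.mem_iInf, LinearMap.mem_ker]

theorem mul_mem_fieldFns {φ ψ : D.Alg U} (h : φ ∈ D.fieldFns U) (h' : ψ ∈ D.fieldFns U) :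
    φ * ψ ∈ D.fieldFns U := by
  rw [mem_fieldFns] at *
  intro s r Λ
  refine (del_mul (.inr (D.gh r, Λ)) φ ψ).trans ?_
  have h1 : del (.inr (D.gh r, Λ)) φ = 0 := h s r Λ
  have h2 : del (.inr (D.gh r, Λ)) ψ = 0 := h' s r Λ
  rw [h1, h2, zero_mul, mul_zero, add_zero]

/-- The commutator of a ghost derivative with `d_i` is again a derivative in a jet of the same
ghost. -/
theorem totalDL_mem_fieldFns {φ : D.Alg U} (h : φ ∈ D.fieldFns U) (i : Fin D.n) :
    totalDL i φ ∈ D.fieldFns U := by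
  rw [mem_fieldFns] at *
  intro s r Λ
  rw [pd_totalDL, h, h, map_zero, ite_self, add_zero]

theorem totalDsL_mem_fieldFns {φ : D.Alg U} (h : φ ∈ D.fieldFns U) (Λ : MIdx D.n) :
    totalDsL Λ φ ∈ D.fieldFns U := by
  induction Λ using midx_induction with
  | h0 => simpa [totalDsL_zero] using h
  | h1 Λ i ih => rw [totalDsL_add_single]; exact totalDL_mem_fieldFns ih i

theorem adj_mem_fieldFns {f : MIdx D.n →₀ D.Alg U} (h : ∀ Λ, f Λ ∈ D.fieldFns U) (Λ : MIdx D.n) :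
    adj f Λ ∈ D.fieldFns U := by
  rw [adj_eq]
  exact Submodule.sum_mem _ fun Ξ _ =>
    Submodule.smul_mem _ _ (totalDsL_mem_fieldFns (h Ξ) _)

theorem prolong_onGhosts_of_mem_fieldFns (f : ∀ s : Fin (D.N + 1), D.Gh s → D.Alg U)
    {φ : D.Alg U} (h : φ ∈ D.fieldFns U) : prolong (onGhosts f) φ = 0 := by
  rw [prolong_eq]
  refine (vf_congr (g := 0) fun a ha => ?_).trans (vf_zero φ)
  rcases a with i | ⟨v, Λ⟩
  · rfl
  · induction v using var_cases with
    | hf A => simp [prolongComp]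
    | hg s r => exact absurd (mem_fieldFns.1 h s r Λ) ha

/-! ### Differential operators linear in ghosts -/

/-- The value `∑ d_Λ(ζ^r) η(f_r)^Λ` of a linear differential operator on `ζ`. -/
def linOp {s : Fin (D.N + 1)} (f : D.Gh s → (MIdx D.n →₀ D.Alg U)) (ζ : D.Gh s → D.Alg U) :
    D.Alg U :=
  ∑ r, ∑ᶠ Λ : MIdx D.n, totalDsL Λ (ζ r) * adj (f r) Λ

theorem finite_support_totalDsL_mul_adj (f : MIdx D.n →₀ D.Alg U) (φ : D.Alg U) :
    (Function.support fun Λ : MIdx D.n => totalDsL Λ φ * adj f Λ).Finite :=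
  (finite_adj_ne_zero f).subset fun Λ h h' => h (by simp only [h', mul_zero])

theorem linOp_smul {s : Fin (D.N + 1)} (f : D.Gh s → (MIdx D.n →₀ D.Alg U)) (c : ℝ)
    (ζ : D.Gh s → D.Alg U) : linOp f (fun r => c • ζ r) = c • linOp f ζ := by
  simp only [linOp, map_smul, smul_mul_assoc, Finset.smul_sum]
  exact Finset.sum_congr rfl fun r _ =>
    (smul_finsum' c (finite_support_totalDsL_mul_adj (f r) (ζ r))).symm

theorem linOp_jetVar {s : Fin (D.N + 1)} (f : D.Gh s → (MIdx D.n →₀ D.Alg U)) :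
    linOp f (fun r => jetVar (D.gh r) 0) =
      ∑ r, ∑ᶠ Λ : MIdx D.n, jetVar (D.gh r) Λ * adj (f r) Λ := by
  simp only [linOp, totalDsL_jetVar, zero_add]

theorem hasParity_linOp {s : Fin (D.N + 1)} {f : D.Gh s → (MIdx D.n →₀ D.Alg U)}
    {ζ : D.Gh s → D.Alg U} {p q t : ZMod 2} (hζ : ∀ r, HasParity (t + parity (D.gh r)) (ζ r))
    (hf : ∀ r Λ, HasParity (parity (D.gh r) + p + q) (f r Λ)) :
    HasParity (t + q + p) (linOp f ζ) := by
  refine hasParity_sum fun r _ => hasParity_finsum fun Λ => ?_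
  have := ((hζ r).totalDsL Λ).mul (hasParity_adj (hf r) Λ)
  convert this using 1
  rw [show t + parity (D.gh r) + (parity (D.gh r) + p + q) =
    t + (parity (D.gh r) + parity (D.gh r)) + (p + q) by ring, zmod_two_add_self]
  ring

/-- The coefficients depend on fields only and are annihilated, and `d_Λ` commutes with the
derivation, so it acts on the argument `ζ` alone. This serves both to evaluate `γ(u^A)` and to count
ghosts. -/
theorem prolong_onGhosts_linOp {t : ZMod 2} {h : ∀ s : Fin (D.N + 1), D.Gh s → D.Alg U}
    (hh : ∀ s r, HasParity (t + parity (D.gh r)) (h s r)) {s : Fin (D.N + 1)}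
    {f : D.Gh s → (MIdx D.n →₀ D.Alg U)} (hf : ∀ r Λ, f r Λ ∈ D.fieldFns U)
    (ζ : D.Gh s → D.Alg U) :
    prolong (onGhosts h) (linOp f ζ) = linOp f fun r => prolong (onGhosts h) (ζ r) := by
  unfold linOp
  rw [prolong_sum]
  refine Finset.sum_congr rfl fun r _ => ?_
  have hs : ∀ φ : D.Alg U, (Function.support fun Λ : MIdx D.n => totalDsL Λ φ * adj (f r) Λ) ⊆
      (finite_adj_ne_zero (f r)).toFinset := by
    intro φ Λ h1
    rw [Set.Finite.coe_toFinset]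
    exact fun h2 => h1 (by simp only [h2, mul_zero])
  rw [finsum_eq_sum_of_support_subset _ (hs _), finsum_eq_sum_of_support_subset _ (hs _),
    prolong_sum]
  refine Finset.sum_congr rfl fun Λ _ => ?_
  rw [prolong_mul (hasParity_onGhosts hh), prolong_onGhosts_of_mem_fieldFns _
    (adj_mem_fieldFns (hf r) Λ), mul_zero, add_zero, prolong_totalDsL (hasParity_onGhosts hh)]

/-! ### The counting operator of ghosts -/

variable (D U) in
/-- The derivation that counts ghosts. -/
def ghostCount : D.Alg U → D.Alg U :=
  prolong (onGhosts fun _ r => jetVar (D.gh r) 0)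

theorem hasParity_ghosts (s : Fin (D.N + 1)) (r : D.Gh s) :
    HasParity (0 + parity (D.gh r)) (jetVar (D.gh r) 0 : D.Alg U) := by
  rw [zero_add]
  exact hasParity_jetVar _ _

theorem ghostCount_mul (φ ψ : D.Alg U) :
    ghostCount D U (φ * ψ) = ghostCount D U φ * ψ + φ * ghostCount D U ψ := by
  have := prolong_mul (hasParity_onGhosts (hasParity_ghosts (U := U))) φ ψ
  rwa [gradeInvPow_zero] at this

theorem ghostCount_jetVar {s : Fin (D.N + 1)} (r : D.Gh s) (Λ : MIdx D.n) :
    ghostCount D U (jetVar (D.gh r) Λ) = jetVar (D.gh r) Λ := by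
  have := prolong_totalDsL (hasParity_onGhosts (hasParity_ghosts (U := U))) Λ (jetVar (D.gh r) 0)
  rwa [totalDsL_jetVar, prolong_jetVar, onGhosts_gh, totalDsL_jetVar, zero_add] at this

theorem ghostCount_linOp {s : Fin (D.N + 1)} {f : D.Gh s → (MIdx D.n →₀ D.Alg U)}
    (hf : ∀ r Λ, f r Λ ∈ D.fieldFns U) {c : ℝ} {ζ : D.Gh s → D.Alg U}
    (hζ : ∀ r, ghostCount D U (ζ r) = c • ζ r) :
    ghostCount D U (linOp f ζ) = c • linOp f ζ := by
  rw [← linOp_smul]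
  simp only [← hζ]
  exact prolong_onGhosts_linOp hasParity_ghosts hf ζ

/-! ### Polynomials in ghosts -/

/-- The monomial of jets of ghosts listed in `l`. -/
def ghostMonomial (l : List ((Σ s : Fin (D.N + 1), D.Gh s) × MIdx D.n)) : D.Alg U :=
  (l.map fun q => (jetVar (D.gh q.1.2) q.2 : D.Alg U)).prod

theorem ghostMonomial_cons (q : (Σ s : Fin (D.N + 1), D.Gh s) × MIdx D.n)
    (l : List ((Σ s : Fin (D.N + 1), D.Gh s) × MIdx D.n)) :
    (ghostMonomial (q :: l) : D.Alg U) = jetVar (D.gh q.1.2) q.2 * ghostMonomial l := by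
  simp only [ghostMonomial, List.map_cons, List.prod_cons]

theorem ghostCount_ghostMonomial (l : List ((Σ s : Fin (D.N + 1), D.Gh s) × MIdx D.n)) :
    ghostCount D U (ghostMonomial l) = (l.length : ℝ) • ghostMonomial l := by
  induction l with
  | nil => simpa [ghostMonomial] using! prolong_apply_one _
  | cons q l ih =>
    rw [ghostMonomial_cons, ghostCount_mul, ghostCount_jetVar, ih, mul_smul_comm,
      List.length_cons, Nat.cast_succ, add_smul, one_smul, add_comm]

theorem exists_hasParity_ghostMonomial
    (l : List ((Σ s : Fin (D.N + 1), D.Gh s) × MIdx D.n)) :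
    ∃ p, HasParity p (ghostMonomial l : D.Alg U) := by
  induction l with
  | nil => exact ⟨0, hasParity_one⟩
  | cons q l ih =>
    obtain ⟨p, hp⟩ := ih
    rw [ghostMonomial_cons]
    exact ⟨_, (hasParity_jetVar _ _).mul hp⟩

theorem mul_ghostMonomial_mem_ghostPoly {a : D.Alg U} (ha : a ∈ D.fieldFns U)
    (l : List ((Σ s : Fin (D.N + 1), D.Gh s) × MIdx D.n)) {i d : ℕ} (hi : l.length = i)
    (hd : (l.map fun q => (q.1.1 : ℕ) + 1).sum = d) :
    a * ghostMonomial l ∈ D.ghostPoly U i d :=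
  Submodule.subset_span ⟨a, ha, l, hi, hd, rfl⟩

theorem ghostPoly_induction {i d : ℕ} {P : D.Alg U → Prop} {φ : D.Alg U}
    (hφ : φ ∈ D.ghostPoly U i d)
    (mem : ∀ a ∈ D.fieldFns U, ∀ l : List ((Σ s : Fin (D.N + 1), D.Gh s) × MIdx D.n),
      l.length = i → (l.map fun q => (q.1.1 : ℕ) + 1).sum = d → P (a * ghostMonomial l))
    (zero : P 0) (add : ∀ x y, P x → P y → P (x + y)) (smul : ∀ (c : ℝ) x, P x → P (c • x)) :
    P φ := by
  induction hφ using Submodule.span_induction with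
  | mem x h =>
    obtain ⟨a, ha, l, h1, h2, rfl⟩ := h
    exact mem a ha l h1 h2
  | zero => exact zero
  | add x y _ _ hx hy => exact add x y hx hy
  | smul c x _ hx => exact smul c x hx

/-- Euler's identity for homogeneous polynomials in the ghosts and their jets. -/
theorem ghostCount_of_mem_ghostPoly {i d : ℕ} {φ : D.Alg U} (h : φ ∈ D.ghostPoly U i d) :
    ghostCount D U φ = (i : ℝ) • φ := by
  refine ghostPoly_induction (P := fun φ => ghostCount D U φ = (i : ℝ) • φ) h ?_ ?_ ?_ ?_
  · rintro a ha l rfl -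
    rw [ghostCount_mul, ghostCount_ghostMonomial, mul_smul_comm, ghostCount,
      prolong_onGhosts_of_mem_fieldFns _ ha, zero_mul, zero_add]
  · rw [smul_zero]
    exact prolong_apply_zero _
  · intro x y hx hy
    rw [smul_add, ← hx, ← hy]
    exact prolong_apply_add _ _ _
  · intro c x hx
    rw [smul_comm, ← hx]
    exact prolong_apply_smul _ _ _

/-- By the Leibniz rule `d_i` raises the jet order of one factor at a time, which changes neither
the degree nor the ghost number. -/
theorem totalDL_ghostMonomial_mem_span (i : Fin D.n)
    (l : List ((Σ s : Fin (D.N + 1), D.Gh s) × MIdx D.n)) :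
    totalDL i (ghostMonomial l : D.Alg U) ∈ Submodule.span ℝ {φ : D.Alg U |
      ∃ l' : List ((Σ s : Fin (D.N + 1), D.Gh s) × MIdx D.n), l'.length = l.length ∧
        (l'.map fun q => (q.1.1 : ℕ) + 1).sum = (l.map fun q => (q.1.1 : ℕ) + 1).sum ∧
        φ = ghostMonomial l'} := by
  induction l with
  | nil =>
    have : totalDL i (ghostMonomial [] : D.Alg U) = 0 := vf_one _
    rw [this]
    exact Submodule.zero_mem _
  | cons q l ih =>
    rw [ghostMonomial_cons, totalDL_mul, totalDL_jetVar]
    refine Submodule.add_mem _ (Submodule.subset_span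
      ⟨(q.1, q.2 + Finsupp.single i 1) :: l, by simp, by simp, ?_⟩) ?_
    · rw [ghostMonomial_cons]
    · have := Submodule.mem_map_of_mem
        (f := LinearMap.mulLeft ℝ (jetVar (D.gh q.1.2) q.2 : D.Alg U)) ih
      rw [Submodule.map_span] at this
      refine Submodule.span_mono ?_ this
      rintro _ ⟨_, ⟨l', h1, h2, rfl⟩, rfl⟩
      exact ⟨q :: l', by simp [h1], by simp [h2], (ghostMonomial_cons q l').symm⟩

theorem totalDL_mem_ghostPoly {k d : ℕ} {φ : D.Alg U} (h : φ ∈ D.ghostPoly U k d) (i : Fin D.n) :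
    totalDL i φ ∈ D.ghostPoly U k d := by
  refine ghostPoly_induction (P := fun φ => totalDL i φ ∈ D.ghostPoly U k d) h ?_ ?_ ?_ ?_
  · intro a ha l hl hd
    rw [totalDL_mul]
    refine Submodule.add_mem _
      (mul_ghostMonomial_mem_ghostPoly (totalDL_mem_fieldFns ha i) l hl hd) ?_
    have := Submodule.mem_map_of_mem (f := LinearMap.mulLeft ℝ a)
      (totalDL_ghostMonomial_mem_span (U := U) i l)
    rw [Submodule.map_span] at this
    refine Submodule.span_le.2 ?_ this
    rintro _ ⟨_, ⟨l', h1, h2, rfl⟩, rfl⟩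
    exact mul_ghostMonomial_mem_ghostPoly ha l' (h1.trans hl) (h2.trans hd)
  · rw [map_zero]
    exact Submodule.zero_mem _
  · intro x y hx hy
    rw [map_add]
    exact Submodule.add_mem _ hx hy
  · intro c x hx
    rw [map_smul]
    exact Submodule.smul_mem _ _ hx

theorem totalDsL_mem_ghostPoly {k d : ℕ} {φ : D.Alg U} (h : φ ∈ D.ghostPoly U k d)
    (Λ : MIdx D.n) : totalDsL Λ φ ∈ D.ghostPoly U k d := by
  induction Λ using midx_induction with
  | h0 => simpa [totalDsL_zero] using h
  | h1 Λ i ih => rw [totalDsL_add_single]; exact totalDL_mem_ghostPoly ih i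

/-- In `ghostPoly` the coefficients stand to the left of the ghosts. A homogeneous `ψ` moves past a
monomial with a mere sign. -/
theorem mul_mem_ghostPoly {k d : ℕ} {φ ψ : D.Alg U} (h : φ ∈ D.ghostPoly U k d)
    (hψ : ψ ∈ D.fieldFns U) {p : ZMod 2} (hp : HasParity p ψ) :
    φ * ψ ∈ D.ghostPoly U k d := by
  refine ghostPoly_induction (P := fun φ => φ * ψ ∈ D.ghostPoly U k d) h ?_ ?_ ?_ ?_
  · intro a ha l hl hd
    obtain ⟨q, hq⟩ := exists_hasParity_ghostMonomial (U := U) l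
    rw [mul_assoc, hq.mul_comm hp, mul_smul_comm, ← mul_assoc]
    exact Submodule.smul_mem _ _
      (mul_ghostMonomial_mem_ghostPoly (mul_mem_fieldFns ha hψ) l hl hd)
  · rw [zero_mul]
    exact Submodule.zero_mem _
  · intro x y hx hy
    rw [add_mul]
    exact Submodule.add_mem _ hx hy
  · intro c x hx
    rw [smul_mul_assoc]
    exact Submodule.smul_mem _ _ hx

theorem linOp_mem_ghostPoly {s : Fin (D.N + 1)} {f : D.Gh s → (MIdx D.n →₀ D.Alg U)}
    (hf : ∀ r Λ, f r Λ ∈ D.fieldFns U) {p : D.Gh s → ZMod 2}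
    (hp : ∀ r Λ, HasParity (p r) (f r Λ)) {k d : ℕ} {ζ : D.Gh s → D.Alg U}
    (hζ : ∀ r, ζ r ∈ D.ghostPoly U k d) : linOp f ζ ∈ D.ghostPoly U k d := by
  refine Submodule.sum_mem _ fun r _ => ?_
  rw [finsum_eq_sum _ (finite_support_totalDsL_mul_adj _ _)]
  exact Submodule.sum_mem _ fun Λ _ => mul_mem_ghostPoly (totalDsL_mem_ghostPoly (hζ r) Λ)
    (adj_mem_fieldFns (hf r) Λ) (hasParity_adj (hp r) Λ)

/-- Every ghost has positive ghost number. -/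
theorem iSup_ghostPoly_le (d : ℕ) :
    ⨆ i : {i : ℕ // d ≤ i}, D.ghostPoly U i d ≤ D.ghostPoly U d d := by
  refine iSup_le fun ⟨i, hi⟩ => ?_
  rcases hi.eq_or_lt with rfl | hlt
  · exact le_rfl
  -- For `i > d` there are no generators: a product of `i` ghosts has ghost number at least `i`.
  · refine Submodule.span_le.2 ?_
    rintro _ ⟨a, -, l, h1, h2, -⟩
    have : l.length ≤ (l.map fun q => (q.1.1 : ℕ) + 1).sum := by
      clear * -
      induction l with
      | nil => simp
      | cons q l ih => simp only [List.length_cons, List.map_cons, List.sum_cons]; omega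
    exact absurd hlt (by dsimp only at h1; omega)

/-! ### The local argument: Noether's second theorem and the quadratic part of nilpotency. -/

namespace LocalTheory

variable (T : LocalTheory D U)

/-! ### The gauge symmetry and its nilpotent extension -/

theorem u_eq_linOp (A : D.Fld) :
    T.u A = linOp (fun r => T.Δ₀ r A) fun r => jetVar (D.gh r) 0 :=
  (linOp_jetVar _).symm

theorem uStage_eq_linOp (s : Fin D.N) (r : D.Gh s.castSucc) :
    T.uStage s r = linOp (fun r' => T.Δ s r' r) fun r => jetVar (D.gh r) 0 :=
  (linOp_jetVar _).symm

theorem factorizesBy_iff {υ : D.Fld → D.Alg U} {ζ : D.Gh 0 → D.Alg U} :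
    T.FactorizesBy υ ζ ↔ ∀ A, υ A = linOp (fun r => T.Δ₀ r A) ζ := by
  simp only [FactorizesBy, linOp, totalDs_eq, uCoeff]

theorem hasParity_Δ₀ (r : D.Gh 0) (A : D.Fld) (Λ : MIdx D.n) :
    HasParity (parity (D.gh r) + parity (D.fld A) + 1) (T.Δ₀ r A Λ) :=
  hasParity_of_mem_parityPart (T.Δ₀_parity r A Λ)

theorem hasParity_u (A : D.Fld) : HasParity (1 + parity (D.fld A)) (T.u A) := by
  have := hasParity_linOp (hasParity_ghosts (U := U) 0) fun r Λ => T.hasParity_Δ₀ r A Λ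
  rwa [zero_add, ← u_eq_linOp] at this

/-- The component is zero on `N`-stage ghosts and a linear operator in the next-stage ghosts
otherwise, so only these two cases need checking. -/
theorem uHigher_induction {P : ∀ s : Fin (D.N + 1), D.Gh s → D.Alg U → Prop}
    (h0 : ∀ s r, P s r 0) (h1 : ∀ (s : Fin D.N) (r : D.Gh s.castSucc),
      P s.castSucc r (linOp (fun r' => T.Δ s r' r) fun r => jetVar (D.gh r) 0))
    (s : Fin (D.N + 1)) (r : D.Gh s) : P s r (T.uHigher s r) := by
  induction s using Fin.lastCases with
  | last => simpa [uHigher] using h0 _ r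
  | cast s => simpa [uHigher, uStage_eq_linOp] using h1 s r

theorem hasParity_uHigher (s : Fin (D.N + 1)) (r : D.Gh s) :
    HasParity (1 + parity (D.gh r)) (T.uHigher s r) := by
  refine T.uHigher_induction (P := fun s r φ => HasParity (1 + parity (D.gh r)) φ)
    (fun s r => hasParity_zero _) (fun s r => ?_) s r
  have := hasParity_linOp (hasParity_ghosts (U := U) s.succ) fun r' Λ =>
    hasParity_of_mem_parityPart (T.Δ_parity s r' r Λ)
  rwa [zero_add] at this

theorem ghostCount_u (A : D.Fld) : ghostCount D U (T.u A) = T.u A := by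
  rw [u_eq_linOp, ghostCount_linOp (c := 1) (T.Δ₀_field · A), one_smul]
  intro r
  rw [ghostCount_jetVar, one_smul]

theorem ghostCount_uHigher (s : Fin (D.N + 1)) (r : D.Gh s) :
    ghostCount D U (T.uHigher s r) = T.uHigher s r := by
  refine T.uHigher_induction (P := fun s r φ => ghostCount D U φ = φ)
    (fun s r => prolong_apply_zero _) (fun s r => ?_) s r
  rw [ghostCount_linOp (c := 1) (T.Δ_field s · r), one_smul]
  intro r
  rw [ghostCount_jetVar, one_smul]

/-- Only 0-stage ghosts occur in `u^A`, so of all components of `f` only `f 0` matters, and it is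
substituted for `c^r`. -/
theorem prolong_onGhosts_u {t : ZMod 2} {f : ∀ s : Fin (D.N + 1), D.Gh s → D.Alg U}
    (hf : ∀ s r, HasParity (t + parity (D.gh r)) (f s r)) (A : D.Fld) :
    prolong (onGhosts f) (T.u A) = linOp (fun r => T.Δ₀ r A) (f 0) := by
  rw [u_eq_linOp, prolong_onGhosts_linOp hf (T.Δ₀_field · A)]
  simp only [prolong_jetVar, onGhosts_gh]

/-- Noether's second theorem: a derivation that factorizes through the gauge symmetry is a
variational symmetry. -/
theorem isVariationalSymmetry_of_factorizesBy {υ : D.Fld → D.Alg U} {ζ : D.Gh 0 → D.Alg U}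
    (h : T.FactorizesBy υ ζ) : IsVariationalSymmetry T.L (onFields υ) := by
  apply isVariationallyTrivial_of_mem_divergences
  rw [← sub_add_cancel (prolong (onFields υ) T.L)
    (∑ v : D.Var, onFields υ v * varD v T.L)]
  refine Submodule.add_mem _ (prolong_sub_sum_mem_divergences _ _) ?_
  have hsum : ∑ v : D.Var, onFields υ v * varD v T.L = ∑ A, υ A * varD (D.fld A) T.L := by
    simp [onFields, fld, Fintype.sum_sum_type]
  rw [hsum]
  -- The Noether identities weighted by `ζ^r` sum to zero. Subtracting this zero makes each
  -- remaining term an instance of integration by parts.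
  have hz : ∑ A, ∑ r, ζ r * (T.Δ₀ r A).sum (fun Λ a => a * totalDs Λ (varD (D.fld A) T.L)) =
      0 := by
    rw [Finset.sum_comm]
    refine Finset.sum_eq_zero fun r _ => ?_
    rw [← Finset.mul_sum, T.noether r, mul_zero]
  rw [← sub_zero (∑ A, υ A * varD (D.fld A) T.L), ← hz, ← Finset.sum_sub_distrib]
  refine Submodule.sum_mem _ fun A _ => ?_
  rw [T.factorizesBy_iff.1 h A, linOp, Finset.sum_mul, ← Finset.sum_sub_distrib]
  refine Submodule.sum_mem _ fun r _ => ?_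
  rw [finsum_totalDsL_mul_adj, Finsupp.sum, Finsupp.sum, Finset.sum_mul, Finset.mul_sum,
    ← Finset.sum_sub_distrib]
  refine Submodule.sum_mem _ fun Λ _ => ?_
  -- The sign of the adjoint and the sign from integration by parts multiply to 1.
  have := Submodule.smul_mem _ ((-1 : ℝ) ^ Λ.degree)
    (totalDsL_mul_sub_mem_divergences Λ (ζ r * T.Δ₀ r A Λ) (varD (D.fld A) T.L))
  rw [smul_sub, smul_smul, ← mul_pow, neg_one_mul, neg_neg, one_pow, one_smul] at this
  rwa [smul_mul_assoc, totalDs_eq, ← mul_assoc]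

/-- With `N` the counting derivation, `[N, u] = u` because the components of `u` are linear in
ghosts. Therefore `N(u(u^A)) = u(N u^A) + u(u^A) = 2 u(u^A)`. -/
theorem ghostCount_uDer_u (A : D.Fld) :
    ghostCount D U (T.uDer (T.u A)) = (2 : ℝ) • T.uDer (T.u A) := by
  have h := prolong_bracket (hasParity_onGhosts (hasParity_ghosts (U := U)))
    (hasParity_onFields T.hasParity_u) (T.u A)
  rw [zero_mul, sgn_zero, one_smul, sub_eq_iff_eq_add'] at h
  refine h.trans ?_
  have h2 : prolong (onGhosts fun _ r => jetVar (D.gh r) 0) (T.u A) = T.u A := T.ghostCount_u A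
  rw [h2, two_smul, uDer]
  congr 2
  funext v
  induction v using var_cases with
  | hf A =>
    rw [onFields_fld, onGhosts_fld, prolong_apply_zero, smul_zero, sub_zero]
    exact T.ghostCount_u A
  | hg s r =>
    rw [onFields_gh, onGhosts_gh, prolong_apply_zero, prolong_jetVar, onFields_gh, smul_zero,
      sub_zero]

variable {T} {γ : ∀ s : Fin (D.N + 1), D.Gh s → D.Alg U}

theorem IsExtensionTerm.hasParity (hγ : IsExtensionTerm γ) (s : Fin (D.N + 1)) (r : D.Gh s) :
    HasParity (1 + parity (D.gh r)) (γ s r) := by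
  rw [add_comm]
  exact hasParity_of_mem_parityPart (hγ.odd s r)

/-- The ghost number of `γ^r` is 2 and its degree is at least 2, so the degree is exactly 2. Two
ghosts of total ghost number 2 must both be of stage 0. -/
theorem IsExtensionTerm.mem_ghostPoly (hγ : IsExtensionTerm γ) (r : D.Gh 0) :
    γ 0 r ∈ D.ghostPoly U 2 2 := by
  refine iSup_ghostPoly_le 2 ?_
  simpa using hγ.poly 0 r

theorem IsExtensionTerm.gamma1_u (hγ : IsExtensionTerm γ) (A : D.Fld) :
    gamma1 γ (T.u A) = linOp (fun r => T.Δ₀ r A) (γ 0) := by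
  rw [gamma1, T.prolong_onGhosts_u (t := 1)]
  · simp
  · intro s r
    split_ifs
    · exact hγ.hasParity s r
    · exact hasParity_zero _

/-- The part of the nilpotency condition that is quadratic in `0`-stage ghosts. -/
theorem IsExtensionTerm.uDer_u (hγ : IsExtensionTerm γ)
    (hb : IsNilpotentDer (prolong (T.brst γ))) (A : D.Fld) :
    T.uDer (T.u A) = - gamma1 γ (T.u A) := by
  -- Nilpotency is used only on the fields, where `𝐛` reduces to `u`.
  have h := hb (jetVar (D.fld A) 0)
  have hA : T.brst γ (D.fld A) = T.u A := by simp [brst, gaugeOp]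
  rw [prolong_jetVar, hA, brst, gaugeOp, prolong_add, prolong_add,
    T.prolong_onGhosts_u hγ.hasParity, ← hγ.gamma1_u] at h
  change T.uDer (T.u A) + _ + _ = 0 at h
  have hY : ghostCount D U (prolong (onGhosts T.uHigher) (T.u A)) =
      prolong (onGhosts T.uHigher) (T.u A) := by
    rw [T.prolong_onGhosts_u T.hasParity_uHigher, ghostCount_linOp (c := 1) (T.Δ₀_field · A),
      one_smul]
    intro r
    rw [ghostCount_uHigher, one_smul]
  have hZ : ghostCount D U (gamma1 γ (T.u A)) = (2 : ℝ) • gamma1 γ (T.u A) := by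
    rw [hγ.gamma1_u, ghostCount_linOp (c := 2) (T.Δ₀_field · A)]
    intro r
    exact_mod_cast ghostCount_of_mem_ghostPoly (hγ.mem_ghostPoly r)
  have hN := congrArg (ghostCount D U) h
  have h0 : ghostCount D U 0 = 0 := prolong_apply_zero _
  have hadd : ∀ φ ψ, ghostCount D U (φ + ψ) = ghostCount D U φ + ghostCount D U ψ :=
    prolong_apply_add _
  rw [hadd, hadd, h0, T.ghostCount_uDer_u, hY, hZ] at hN
  generalize T.uDer (T.u A) = X at *
  generalize prolong (onGhosts T.uHigher) (T.u A) = Y at *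
  generalize gamma1 γ (T.u A) = Z at *
  -- Counting ghosts turns `X + Y + Z = 0` into `2X + Y + 2Z = 0`, since `X` and `Z` are quadratic
  -- and `Y` is linear. Twice the first relation minus the second isolates `Y`.
  have hY0 : Y = 0 := by
    have : Y = (2 : ℝ) • (X + Y + Z) - ((2 : ℝ) • X + Y + (2 : ℝ) • Z) := by module
    rw [this, h, hN, smul_zero, sub_zero]
  rw [hY0, add_zero] at h
  exact eq_neg_of_add_eq_zero_left h

/-- The Lie antibracket of the gauge symmetry. -/
theorem IsExtensionTerm.lieBracket_uDer (hγ : IsExtensionTerm γ)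
    (hb : IsNilpotentDer (prolong (T.brst γ))) (φ : D.Alg U) :
    lieBracket 1 1 T.uDer T.uDer φ =
      prolong (onFields fun A => (-2 : ℝ) • gamma1 γ (T.u A)) φ := by
  have h := prolong_bracket (hasParity_onFields T.hasParity_u)
    (hasParity_onFields T.hasParity_u) φ
  rw [mul_one, sgn_one] at h
  rw [lieBracket, mul_one, pow_one]
  refine h.trans ?_
  congr 1
  funext v
  induction v using var_cases with
  | hf A =>
    -- For an odd derivation the bracket with itself is twice its square, so the component is `2
    -- u(u^A)`.
    rw [onFields_fld, onFields_fld]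
    have := hγ.uDer_u hb A
    rw [uDer] at this
    rw [this]
    module
  | hg s r => rw [onFields_gh, onFields_gh, prolong_apply_zero, smul_zero, sub_zero]

theorem IsExtensionTerm.factorizesBy (hγ : IsExtensionTerm γ) :
    T.FactorizesBy (fun A => (-2 : ℝ) • gamma1 γ (T.u A)) fun r => (-2 : ℝ) • γ 0 r := by
  rw [factorizesBy_iff]
  intro A
  rw [hγ.gamma1_u, linOp_smul]

theorem IsExtensionTerm.isGeneralizedGaugeSymmetry (hγ : IsExtensionTerm γ) :
    T.IsGeneralizedGaugeSymmetry fun A => (-2 : ℝ) • gamma1 γ (T.u A) where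
  operator A := by
    refine Submodule.mem_iSup_of_mem 2 (Submodule.smul_mem _ _ ?_)
    rw [hγ.gamma1_u]
    exact linOp_mem_ghostPoly (T.Δ₀_field · A) (T.hasParity_Δ₀ · A) hγ.mem_ghostPoly
  symmetry := T.isVariationalSymmetry_of_factorizesBy hγ.factorizesBy

end LocalTheory

/-! ### Globality of the antibracket. -/

namespace FieldBundle

variable {B : FieldBundle D}

theorem Agree.add {κ κ' : B.Coords} {φ ψ : κ.Alg} {φ' ψ' : κ'.Alg} (h : Agree κ κ' φ φ')
    (h' : Agree κ κ' ψ ψ') : Agree κ κ' (φ + ψ) (φ' + ψ') := fun q x c hx hx' => by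
  rw [map_add, map_add, h q x c hx hx', h' q x c hx hx']

/-- The antibracket of an odd globally defined derivation with itself is globally defined. -/
theorem IsGlobalDer.lieBracket_self {δ : ∀ κ : B.Coords, κ.Alg → κ.Alg} (h : IsGlobalDer δ) :
    IsGlobalDer fun κ => lieBracket 1 1 (δ κ) (δ κ) := by
  intro κ κ' φ φ' hφ
  have := h _ _ _ _ (h _ _ _ _ hφ)
  simpa only [lieBracket, mul_one, pow_one, neg_smul, one_smul, sub_neg_eq_add]
    using this.add this

end FieldBundle

end GradedJet

end

theorem proposition7 {D : GradedJet.FieldContent} (B : GradedJet.FieldBundle D)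
    (T : B.GaugeTheory)
    (γ : ∀ (κ : B.Coords) (s : Fin (D.N + 1)), D.Gh s → κ.Alg)
    (hγ : T.IsNilpotentExtension γ) :
    -- the derivation `-2γ^{(1)}(u)` is globally defined, and in all bundle coordinates:
    GradedJet.FieldBundle.IsGlobalDer (B := B) (fun κ => GradedJet.prolong
      (GradedJet.FieldContent.onFields fun A =>
        (-2 : ℝ) • GradedJet.LocalTheory.gamma1 (γ κ) ((T.loc κ).u A))) ∧
    ∀ κ : B.Coords,
      -- `[u, u] = -2γ^{(1)}(u)` as graded derivations,
      (∀ φ : κ.Alg, GradedJet.lieBracket 1 1 (T.loc κ).uDer (T.loc κ).uDer φ =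
        GradedJet.prolong (GradedJet.FieldContent.onFields fun A =>
          (-2 : ℝ) • GradedJet.LocalTheory.gamma1 (γ κ) ((T.loc κ).u A)) φ) ∧
      -- this derivation is a generalized gauge symmetry of the Lagrangian,
      (T.loc κ).IsGeneralizedGaugeSymmetry (fun A =>
        (-2 : ℝ) • GradedJet.LocalTheory.gamma1 (γ κ) ((T.loc κ).u A)) ∧
      -- it factorizes through `u` by putting `c^r = -2γ^r`,
      (T.loc κ).FactorizesBy (fun A =>
        (-2 : ℝ) • GradedJet.LocalTheory.gamma1 (γ κ) ((T.loc κ).u A))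
        (fun r => (-2 : ℝ) • γ κ 0 r) ∧
      -- where `γ^r` are quadratic in the `0`-stage ghosts and their jets
      (∀ r, γ κ 0 r ∈ D.ghostPoly κ.dom 2 2) := by
  have hbr : ∀ (κ : B.Coords) (φ : κ.Alg),
      GradedJet.lieBracket 1 1 (T.loc κ).uDer (T.loc κ).uDer φ =
        GradedJet.prolong (GradedJet.FieldContent.onFields fun A =>
          (-2 : ℝ) • GradedJet.LocalTheory.gamma1 (γ κ) ((T.loc κ).u A)) φ :=
    fun κ => (hγ.term κ).lieBracket_uDer (hγ.nilpotent κ)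
  refine ⟨?_, fun κ => ⟨hbr κ, (hγ.term κ).isGeneralizedGaugeSymmetry,
    (hγ.term κ).factorizesBy, (hγ.term κ).mem_ghostPoly⟩⟩
  -- Globality is proved for `[u, u]` and transported along the bracket formula, so no
  -- transformation law for the single components of `γ` is needed.
  have hglob := T.symmetry_global.lieBracket_self
  intro κ κ' φ φ' h
  simp only [← hbr]
  exact hglob κ κ' φ φ' h
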